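/- Let $\mathbb K=\mathbb R$ or $\mathbb C$, let $\mathfrak g$ be a semisimple Lie algebra over $\mathbb K$ with basis $e_1,\dots,e_m$ and structure constants $[e_i,e_j]=\sum_k c_{ij}^k e_k$, let $l\ge 0$, and equip $\mathbb K^{2l+m}$, with coordinates $(x_1,\dots,x_l,y_1,\dots,y_l,z_1,\dots,z_m)$, with the Poisson structure $$\Pi=\sum_{i=1}^l \frac{\partial}{\partial x_i}\wedge\frac{\partial}{\partial y_i}+\frac12\sum_{i,j,k}c_{ij}^k z_k\frac{\partial}{\partial z_i}\wedge\frac{\partial}{\partial z_j},$$ with Poisson bracket $\{\cdot,\cdot\}$ and Hamiltonian vector fields $X_f=\{f,\cdot\}$. Let $H$ be a formal power series at $0$ (for instance the Taylor series of a function that is analytic near $0$) with $X_H(0)=0$. Then there is a formal canonical coordinate system $(\hat x_i,\hat y_i,\hat z_j)$ centred at $0$, that is, formal power series that vanish at $0$, have invertible Jacobian matrix at $0$, and in which $\Pi$ keeps its form: $$\Pi=\sum_{i=1}^l \frac{\partial}{\partial \hat x_i}\wedge\frac{\partial}{\partial \hat y_i}+\frac12\sum_{i,j,k}c_{ij}^k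 \hat z_k\frac{\partial}{\partial \hat z_i}\wedge\frac{\partial}{\partial \hat z_j},$$ and in which $$H=H_{ss}+\tilde H,\qquad \{H,H_{ss}\}=0,$$ where $\tilde H$ is a formal power series and $H_{ss}$ is a polynomial in $(\hat x,\hat y,\hat z)$ of degree at most $2$ without constant term whose Hamiltonian vector field $X_{H_{ss}}$ is, in the coordinates $(\hat x,\hat y,\hat z)$, a linear vector field equal to the semisimple part (in the Jordan–Chevalley decomposition) of the linear part of $X_H$ in these coordinates. In particular, the semisimple part of the linear part of $X_H$ in these coordinates is a Hamiltonian vector field. -/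

import Mathlib

/-- Labels of the coordinates `(x₁, …, x_l, y₁, …, y_l, z₁, …, z_m)` on `𝕜^(2l+m)`. -/
abbrev Coord (l m : ℕ) : Type := Fin l ⊕ Fin l ⊕ Fin m

/-- The label of the coordinate `xᵢ`. -/
abbrev Coord.x {l m : ℕ} (i : Fin l) : Coord l m := Sum.inl i

/-- The label of the coordinate `yᵢ`. -/
abbrev Coord.y {l m : ℕ} (i : Fin l) : Coord l m := Sum.inr (Sum.inl i)

/-- The label of the coordinate `zⱼ`. -/
abbrev Coord.z {l m : ℕ} (j : Fin m) : Coord l m := Sum.inr (Sum.inr j)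

noncomputable section

namespace FormalPoisson

open MvPowerSeries

/-- Formal functions at the origin of `𝕜^(2l+m)`. -/
abbrev FormalFn (𝕜 : Type*) (l m : ℕ) : Type _ := MvPowerSeries (Coord l m) 𝕜

/-- Formal vector fields `∑ₐ Vₐ ∂/∂uₐ`, given by their components. -/
abbrev FormalVF (𝕜 : Type*) (l m : ℕ) : Type _ := Coord l m → FormalFn 𝕜 l m

/-- The derivative `V(f) = ∑ₐ Vₐ ∂f/∂uₐ` of a formal function along a formal vector field. -/
def FormalVF.deriv {𝕜 : Type*} [CommRing 𝕜] {l m : ℕ} (V : FormalVF 𝕜 l m)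
    (f : FormalFn 𝕜 l m) : FormalFn 𝕜 l m :=
  ∑ a, V a * pderiv 𝕜 a f

/-- The linear part of a formal vector field, as a matrix: row `a` holds the coefficients of the
degree one part of the `a`-th component. The same is used for the linear part of a formal map. -/
def linearPart {𝕜 : Type*} [CommRing 𝕜] {l m : ℕ} (V : FormalVF 𝕜 l m) :
    Matrix (Coord l m) (Coord l m) 𝕜 :=
  Matrix.of fun a b => coeff (Finsupp.single b 1) (V a)

/-- The linear vector field `∑ₐ (∑_b A_ab u_b) ∂/∂uₐ`. -/
def linearVF {𝕜 : Type*} [CommRing 𝕜] {l m : ℕ}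
    (A : Matrix (Coord l m) (Coord l m) 𝕜) : FormalVF 𝕜 l m :=
  fun a => ∑ b, C (A a b) * X b

/-- `S` is the semisimple part of the matrix `A` in its Jordan–Chevalley decomposition. -/
def IsSemisimplePart {𝕜 : Type*} [Field 𝕜] {ι : Type*} [Fintype ι] [DecidableEq ι]
    (S A : Matrix ι ι 𝕜) : Prop :=
  Module.End.IsSemisimple (Matrix.toLin' S) ∧ IsNilpotent (A - S) ∧ Commute S (A - S)

section Poisson

variable {𝕜 : Type*} [Field 𝕜] {𝔤 : Type*} [LieRing 𝔤] [LieAlgebra 𝕜 𝔤] {l m : ℕ}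

/-- The structure constants `c_ij^k` of a Lie algebra in a basis: `[eᵢ, eⱼ] = ∑ₖ c_ij^k eₖ`. -/
def structConst (e : Module.Basis (Fin m) 𝕜 𝔤) (i j k : Fin m) : 𝕜 :=
  e.repr ⁅e i, e j⁆ k

/-- The Poisson bracket of
`Π = ∑ᵢ ∂/∂xᵢ ∧ ∂/∂yᵢ + 1/2 ∑_{i,j,k} c_ij^k zₖ ∂/∂zᵢ ∧ ∂/∂zⱼ` on formal functions. -/
def bracket (e : Module.Basis (Fin m) 𝕜 𝔤) (f g : FormalFn 𝕜 l m) : FormalFn 𝕜 l m :=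
  (∑ i : Fin l, (pderiv 𝕜 (Coord.x i) f * pderiv 𝕜 (Coord.y i) g
      - pderiv 𝕜 (Coord.y i) f * pderiv 𝕜 (Coord.x i) g))
  + C (1 / 2 : 𝕜) * ∑ i : Fin m, ∑ j : Fin m, ∑ k : Fin m,
      C (structConst e i j k) * X (Coord.z k) *
        (pderiv 𝕜 (Coord.z i) f * pderiv 𝕜 (Coord.z j) g
          - pderiv 𝕜 (Coord.z j) f * pderiv 𝕜 (Coord.z i) g)

/-- The Hamiltonian vector field `X_f = {f, ·}`. -/
def hamVF (e : Module.Basis (Fin m) 𝕜 𝔤) (f : FormalFn 𝕜 l m) : FormalVF 𝕜 l m :=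
  fun a => bracket e f (X a)

/-- `φ = (x̂, ŷ, ẑ)` is a formal coordinate system centred at the origin in which `Π` has the
canonical form, i.e. the new coordinate functions vanish at `0`, have invertible Jacobian matrix
at `0`, and satisfy `{x̂ᵢ, ŷⱼ} = δᵢⱼ`, `{ẑᵢ, ẑⱼ} = ∑ₖ c_ij^k ẑₖ`, all other brackets of
coordinates being zero. -/
structure IsCanonicalCoords (e : Module.Basis (Fin m) 𝕜 𝔤)
    (φ : Coord l m → FormalFn 𝕜 l m) : Prop where
  vanish : ∀ a, constantCoeff (φ a) = 0
  invertible : IsUnit (linearPart φ).det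
  bracket_x_x : ∀ i j, bracket e (φ (Coord.x i)) (φ (Coord.x j)) = 0
  bracket_y_y : ∀ i j, bracket e (φ (Coord.y i)) (φ (Coord.y j)) = 0
  bracket_x_y : ∀ i j, bracket e (φ (Coord.x i)) (φ (Coord.y j)) = if i = j then 1 else 0
  bracket_x_z : ∀ i j, bracket e (φ (Coord.x i)) (φ (Coord.z j)) = 0
  bracket_y_z : ∀ i j, bracket e (φ (Coord.y i)) (φ (Coord.z j)) = 0
  bracket_z_z : ∀ i j, bracket e (φ (Coord.z i)) (φ (Coord.z j)) =
    ∑ k, C (structConst e i j k) * φ (Coord.z k)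

end Poisson

/-- `W` is the expression of the vector field `V` in the coordinates `φ`:
`V = ∑ₐ Wₐ(φ) ∂/∂φₐ`, i.e. `V(φₐ) = Wₐ(φ)` for all `a`. -/
def IsExpressionIn {𝕜 : Type*} [CommRing 𝕜] {l m : ℕ} (φ : Coord l m → FormalFn 𝕜 l m)
    (V W : FormalVF 𝕜 l m) : Prop :=
  ∀ a, V.deriv (φ a) = subst φ (W a)

end FormalPoisson

end

open MvPowerSeries FormalPoisson

open MvPowerSeries FormalPoisson

/-! Give `xᵢ`, `yᵢ` weight 1 and `zⱼ` weight 2. Both parts of `Π` then lower weight by exactly 2, so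
bracketing with a series of weight at least 3 raises weight, and `exp {G, ·}` makes sense as a
formal canonical transformation for every such `G`. As `X_H` vanishes at 0, `H` has no linear terms
in `x, y`; up to a constant its part of weight at most 2 is `h₂`, a quadratic form in `x, y` plus an
element `ξ` of `𝔤` (`exists_quadHam_leading_part`). The field of `h₂` is linear, with a matrix `A`
that is infinitesimally symplectic on `x, y` and `ad ξ` on `z`.

The semisimple part `S` of `A` is again Hamiltonian (`exists_hamMatrix_semisimplePart`): the
symplectic condition says that `A` is intertwined with `-Aᵀ`, and Jordan–Chevalley parts respect
intertwiners; the semisimple part of `ad ξ` is a derivation of `𝔤`, hence inner by semisimplicity.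
Let `s` be the quadratic Hamiltonian of `S`.

Birkhoff normalization now works weight by weight. On polynomials `S` acts semisimply and `A - S`
nilpotently, so modulo higher weight every series is an element of `ker S` plus some `{h₂, u}`
(`exists_homological`); adding `u` to `G` removes the second summand. In the limit `H' = exp {G, ·}
H` satisfies `{s, H'} = 0` (`exists_normalization`), and the coordinates `exp {-G, ·} uₐ` express
`H` as `H'`.

The linear part of `X_{H'}` can differ from `A`, since weight-3 terms such as `xᵢ zⱼ` are quadratic.
The difference strictly raises the weight of coordinates, so its sum with `A - S` stays nilpotent
(`WeightPreserving.isNilpotent_add`), while `{s, H'} = 0` makes `S` commute with the whole linear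
part (`commute_linearPart`). Hence `S` is its semisimple part. -/

namespace FormalPoisson

/-! ### The weight filtration on formal power series. -/

section Filtration

variable {σ K : Type*} [Field K]

/-- The formal power series all of whose monomials have weight at least `n`. -/
def fil (K : Type*) [Field K] (w : σ → ℕ) (n : ℕ) : Submodule K (MvPowerSeries σ K) where
  carrier := {f | ∀ d, Finsupp.weight w d < n → coeff d f = 0}
  add_mem' hf hg d hd := by rw [map_add, hf d hd, hg d hd, add_zero]
  zero_mem' d _ := by simp
  smul_mem' c f hf d hd := by rw [map_smul, hf d hd, smul_zero]

variable {w : σ → ℕ} {n k : ℕ} {f g : MvPowerSeries σ K}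

theorem fil_mono (h : k ≤ n) (hf : f ∈ fil K w n) : f ∈ fil K w k :=
  fun d hd => hf d (hd.trans_le h)

theorem mem_fil_zero : f ∈ fil K w 0 := fun _ hd => absurd hd (Nat.not_lt_zero _)

theorem mul_mem_fil (hf : f ∈ fil K w n) (hg : g ∈ fil K w k) : f * g ∈ fil K w (n + k) := by
  classical
  intro d hd
  rw [coeff_mul]
  refine Finset.sum_eq_zero fun p hp => ?_
  rw [Finset.HasAntidiagonal.mem_antidiagonal] at hp
  have hw : Finsupp.weight w p.1 + Finsupp.weight w p.2 = Finsupp.weight w d := by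
    rw [← map_add, hp]
  rcases lt_or_ge (Finsupp.weight w p.1) n with h | h
  · rw [hf _ h, zero_mul]
  · rw [hg p.2 (by omega), mul_zero]

theorem C_mul_mem_fil (c : K) (hf : f ∈ fil K w n) : C c * f ∈ fil K w n := by
  simpa using mul_mem_fil (mem_fil_zero (f := C c) (w := w)) hf

/-- The filtration is separated. The shift `c` absorbs the bounded loss of weight caused by
derivatives and brackets. -/
theorem eq_zero_of_forall_mem_fil (c : ℕ) (h : ∀ N, f ∈ fil K w (N - c)) : f = 0 := by
  ext d
  exact h (Finsupp.weight w d + 1 + c) d (by omega)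

theorem X_mem_fil (a : σ) : (X a : MvPowerSeries σ K) ∈ fil K w (w a) := by
  classical
  intro d hd
  rw [coeff_X, if_neg]
  rintro rfl
  simp [Finsupp.weight_single] at hd

/-- The subtraction is truncated: for `n ≤ w a` nothing is claimed. -/
theorem pderiv_mem_fil (a : σ) (hf : f ∈ fil K w n) : pderiv K a f ∈ fil K w (n - w a) := by
  intro d hd
  rw [coeff_pderiv, hf, zero_mul]
  rw [map_add, Finsupp.weight_single]
  simp only [smul_eq_mul, one_mul]
  omega

/-- In characteristic zero a series lies in the filtration if its derivatives do. -/
theorem mem_fil_of_pderiv [CharZero K] (h0 : constantCoeff f = 0)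
    (h : ∀ a, pderiv K a f ∈ fil K w (n - w a)) : f ∈ fil K w n := by
  classical
  intro d hd
  by_cases hd0 : d = 0
  · subst hd0; simpa using h0
  obtain ⟨a, ha⟩ : ∃ a, d a ≠ 0 := by
    by_contra! hc
    exact hd0 (Finsupp.ext hc)
  have hle : Finsupp.single a 1 ≤ d := by
    rw [Finsupp.single_le_iff]; omega
  obtain ⟨d', rfl⟩ := exists_add_of_le hle
  have h1 := h a d' (by
    rw [map_add, Finsupp.weight_single] at hd
    simp only [smul_eq_mul, one_mul] at hd
    omega)
  rw [coeff_pderiv, add_comm d'] at h1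
  rcases mul_eq_zero.mp h1 with h2 | h2
  · exact h2
  -- The coefficient of the derivative is multiplied by the exponent of `a`, a positive integer,
  -- which is nonzero in characteristic zero.
  · exact absurd h2 (by exact_mod_cast Nat.succ_ne_zero (d' a))

theorem degree_le_weight (hw : ∀ a, 1 ≤ w a) (d : σ →₀ ℕ) : d.degree ≤ Finsupp.weight w d := by
  rw [Finsupp.weight_apply, Finsupp.degree_apply, Finsupp.sum]
  refine Finset.sum_le_sum fun a _ => ?_
  simpa using Nat.mul_le_mul_left (d a) (hw a)

/-- A series agrees with a polynomial up to terms of high weight. -/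
theorem exists_polynomial_sub_mem_fil [Finite σ] (hw : ∀ a, 1 ≤ w a) (f : MvPowerSeries σ K)
    (N : ℕ) : ∃ p : MvPolynomial σ K, f - p ∈ fil K w N := by
  classical
  -- Truncation by degree suffices, because the degree of a monomial is at most its weight.
  refine ⟨truncTotal N f, fun d hd => ?_⟩
  rw [map_sub, MvPolynomial.coeff_coe, coeff_truncTotal, sub_self]
  exact (degree_le_weight hw d).trans_lt hd

/-- Two linear maps that lower the filtration by a bounded amount agree if they agree on
polynomials. -/
theorem linearMap_ext_of_fil [Finite σ] (hw : ∀ a, 1 ≤ w a)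
    {D E : MvPowerSeries σ K →ₗ[K] MvPowerSeries σ K} (c : ℕ)
    (hD : ∀ n f, f ∈ fil K w n → D f ∈ fil K w (n - c))
    (hE : ∀ n f, f ∈ fil K w n → E f ∈ fil K w (n - c))
    (h : ∀ p : MvPolynomial σ K, D p = E p) : D = E := by
  ext1 f
  rw [← sub_eq_zero]
  refine eq_zero_of_forall_mem_fil (w := w) c fun N => ?_
  obtain ⟨p, hp⟩ := exists_polynomial_sub_mem_fil hw f N
  have : D f - E f = D (f - p) - E (f - p) := by
    rw [map_sub, map_sub, h]; abel
  rw [this]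
  exact sub_mem (hD _ _ hp) (hE _ _ hp)

theorem derivation_coe_eq {D E : Derivation K (MvPowerSeries σ K) (MvPowerSeries σ K)}
    (h : ∀ a, D (X a) = E (X a)) (p : MvPolynomial σ K) : D p = E p := by
  induction p using MvPolynomial.induction_on with
  | C c =>
    have : ((MvPolynomial.C c : MvPolynomial σ K) : MvPowerSeries σ K)
        = algebraMap K (MvPowerSeries σ K) c := by
      rw [MvPolynomial.coe_C]; rfl
    rw [this, D.map_algebraMap, E.map_algebraMap]
  | add p q hp hq => rw [MvPolynomial.coe_add, map_add, map_add, hp, hq]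
  | mul_X p a hp =>
    rw [MvPolynomial.coe_mul, MvPolynomial.coe_X, Derivation.leibniz, Derivation.leibniz, hp, h]

/-- Two derivations that lower the filtration by a bounded amount agree if they agree on the
coordinates. -/
theorem derivation_ext_of_fil [Finite σ] (hw : ∀ a, 1 ≤ w a)
    {D E : Derivation K (MvPowerSeries σ K) (MvPowerSeries σ K)} (c : ℕ)
    (hD : ∀ n f, f ∈ fil K w n → D f ∈ fil K w (n - c))
    (hE : ∀ n f, f ∈ fil K w n → E f ∈ fil K w (n - c))
    (h : ∀ a, D (X a) = E (X a)) : D = E := by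
  have := linearMap_ext_of_fil hw (D := (D : _ →ₗ[K] _)) (E := (E : _ →ₗ[K] _)) c hD hE
    (derivation_coe_eq h)
  exact Derivation.ext fun f => LinearMap.congr_fun this f

theorem prod_pow_mem_fil {φ : σ → MvPowerSeries σ K} (hφ : ∀ a, φ a ∈ fil K w (w a))
    (d : σ →₀ ℕ) : (d.prod fun a e => φ a ^ e) ∈ fil K w (Finsupp.weight w d) := by
  classical
  have hpow : ∀ (e : ℕ) a, φ a ^ e ∈ fil K w (e * w a) := by
    intro e a
    induction e with
    | zero => simpa using mem_fil_zero
    | succ e ih => rw [pow_succ, add_mul, one_mul]; exact mul_mem_fil ih (hφ a)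
  rw [Finsupp.weight_apply, Finsupp.prod, Finsupp.sum]
  induction d.support using Finset.induction_on with
  | empty => simpa using mem_fil_zero
  | insert a s ha ih =>
    rw [Finset.prod_insert ha, Finset.sum_insert ha]
    exact mul_mem_fil (hpow _ _) ih

theorem subst_mem_fil [Finite σ] {φ : σ → MvPowerSeries σ K} (hs : HasSubst φ)
    (hφ : ∀ a, φ a ∈ fil K w (w a)) (hf : f ∈ fil K w n) : subst φ f ∈ fil K w n := by
  intro d hd
  rw [coeff_subst hs]
  refine finsum_eq_zero_of_forall_eq_zero fun e => ?_
  rcases lt_or_ge (Finsupp.weight w e) n with h | h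
  · rw [hf e h, zero_smul]
  · rw [prod_pow_mem_fil hφ e d (hd.trans_le h), smul_zero]

/-- An algebra endomorphism that preserves the filtration is the substitution of the images of the
coordinates. -/
theorem algHom_eq_subst [Finite σ] (hw : ∀ a, 1 ≤ w a)
    (Ψ : MvPowerSeries σ K →ₐ[K] MvPowerSeries σ K)
    (hΨ : ∀ n f, f ∈ fil K w n → Ψ f ∈ fil K w n) (hs : HasSubst fun a => Ψ (X a))
    (f : MvPowerSeries σ K) : Ψ f = subst (fun a => Ψ (X a)) f := by
  rw [← substAlgHom_apply hs]
  refine LinearMap.congr_fun (linearMap_ext_of_fil hw (D := Ψ.toLinearMap)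
    (E := (substAlgHom hs).toLinearMap) 0 hΨ (fun n f hf => ?_) fun p => ?_) f
  · rw [AlgHom.toLinearMap_apply, substAlgHom_apply]
    exact subst_mem_fil hs (fun a => hΨ _ _ (X_mem_fil a)) hf
  · have : Ψ.comp (MvPolynomial.coeToMvPowerSeries.algHom K)
        = (substAlgHom hs).comp (MvPolynomial.coeToMvPowerSeries.algHom K) := by
      ext a
      simp [subst_X hs]
    simpa using DFunLike.congr_fun this p

end Filtration

/-! ### Iterated Leibniz rule for bilinear maps. -/

section Leibniz

variable {K U V W : Type*} [Field K] [AddCommGroup U] [Module K U] [AddCommGroup V] [Module K V]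
  [AddCommGroup W] [Module K W]

/-- The Leibniz rule for the iterates of a derivation of a bilinear map. -/
theorem iterate_leibniz (β : U →ₗ[K] V →ₗ[K] W) {DU : Module.End K U} {DV : Module.End K V}
    {DW : Module.End K W} (h : ∀ u v, DW (β u v) = β (DU u) v + β u (DV v)) (n : ℕ) (u : U) (v : V) :
    (DW ^ n) (β u v) = ∑ ij ∈ Finset.HasAntidiagonal.antidiagonal n,
      n.choose ij.1 • β ((DU ^ ij.1) u) ((DV ^ ij.2) v) := by
  induction n with
  | zero => simp
  | succ n ih =>
    rw [Finset.sum_antidiagonal_choose_succ_nsmul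
      (fun i j => β ((DU ^ i) u) ((DV ^ j) v)) n, pow_succ', Module.End.mul_apply, ih, map_sum,
      ← Finset.sum_add_distrib]
    refine Finset.sum_congr rfl fun ij hij => ?_
    rw [map_nsmul, h, pow_succ' DU, pow_succ' DV, Module.End.mul_apply, Module.End.mul_apply,
      nsmul_add, add_comm]
    congr 2
    rw [Finset.HasAntidiagonal.mem_antidiagonal] at hij
    exact Nat.choose_symm_of_eq_add hij.symm

/-- Dividing by factorials turns the binomial sum into a Cauchy product, the degree-`n` part of `exp
D (β u v) = β (exp D u) (exp D v)`. -/
theorem iterate_leibniz_factorial [CharZero K] (β : U →ₗ[K] V →ₗ[K] W) {DU : Module.End K U}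
    {DV : Module.End K V} {DW : Module.End K W}
    (h : ∀ u v, DW (β u v) = β (DU u) v + β u (DV v)) (n : ℕ) (u : U) (v : V) :
    (n.factorial : K)⁻¹ • (DW ^ n) (β u v) = ∑ ij ∈ Finset.HasAntidiagonal.antidiagonal n,
      β ((ij.1.factorial : K)⁻¹ • (DU ^ ij.1) u) ((ij.2.factorial : K)⁻¹ • (DV ^ ij.2) v) := by
  rw [iterate_leibniz β h, Finset.smul_sum]
  refine Finset.sum_congr rfl fun ij hij => ?_
  rw [Finset.HasAntidiagonal.mem_antidiagonal] at hij
  subst hij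
  rw [map_smul, map_smul, LinearMap.smul_apply, smul_smul, ← Nat.cast_smul_eq_nsmul K, smul_smul]
  congr 1
  have h1 : ((ij.1 + ij.2).factorial : K) ≠ 0 := by exact_mod_cast Nat.factorial_ne_zero _
  have h2 : (ij.1.factorial : K) ≠ 0 := by exact_mod_cast Nat.factorial_ne_zero _
  have h3 : (ij.2.factorial : K) ≠ 0 := by exact_mod_cast Nat.factorial_ne_zero _
  have h4 : ((ij.1 + ij.2).choose ij.1 : K) * ij.1.factorial * ij.2.factorial
      = (ij.1 + ij.2).factorial := by
    rw [Nat.choose_symm_add]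
    exact_mod_cast Nat.add_choose_mul_factorial_mul_factorial _ _
  field_simp
  linear_combination h4

/-- A square sum and a triangular sum differ by terms beyond the diagonal. -/
theorem sum_range_sub_sum_antidiagonal_mem (M : Submodule K W) (N : ℕ) (a : ℕ → ℕ → W)
    (h : ∀ i j, N ≤ i + j → a i j ∈ M) :
    (∑ i ∈ Finset.range N, ∑ j ∈ Finset.range N, a i j)
      - ∑ n ∈ Finset.range N, ∑ ij ∈ Finset.HasAntidiagonal.antidiagonal n, a ij.1 ij.2 ∈ M := by
  have h1 : ∑ n ∈ Finset.range N, ∑ ij ∈ Finset.HasAntidiagonal.antidiagonal n, a ij.1 ij.2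
      = ∑ p ∈ (Finset.range N ×ˢ Finset.range N).filter (fun p => p.1 + p.2 < N), a p.1 p.2 := by
    rw [Finset.sum_sigma']
    refine Finset.sum_nbij' (fun x => x.2) (fun p => ⟨p.1 + p.2, p⟩) ?_ ?_ ?_ ?_ ?_
    · rintro ⟨n, i, j⟩ hx
      simp only [Finset.mem_sigma, Finset.mem_range, Finset.HasAntidiagonal.mem_antidiagonal] at hx
      simp only [Finset.mem_filter, Finset.mem_product, Finset.mem_range]
      omega
    · rintro ⟨i, j⟩ hx
      simp only [Finset.mem_filter, Finset.mem_product, Finset.mem_range] at hx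
      simp only [Finset.mem_sigma, Finset.mem_range, Finset.HasAntidiagonal.mem_antidiagonal]
      exact ⟨hx.2, trivial⟩
    · rintro ⟨n, i, j⟩ hx
      simp only [Finset.mem_sigma, Finset.mem_range, Finset.HasAntidiagonal.mem_antidiagonal] at hx
      obtain ⟨_, rfl⟩ := hx
      rfl
    · rintro ⟨i, j⟩ _; rfl
    · rintro ⟨n, i, j⟩ _; rfl
  rw [h1, ← Finset.sum_product', ← Finset.sum_filter_add_sum_filter_not
    (Finset.range N ×ˢ Finset.range N) (fun p => p.1 + p.2 < N), add_sub_cancel_left]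
  refine sum_mem fun p hp => h _ _ ?_
  rw [Finset.mem_filter] at hp
  exact not_lt.mp hp.2

end Leibniz

/-! ### Exponentials of operators that raise the weight. -/

section Exp

variable {σ K : Type*} [Field K]

/-- A linear operator that raises the filtration by one. -/
def Raises (w : σ → ℕ) (D : Module.End K (MvPowerSeries σ K)) : Prop :=
  ∀ n f, f ∈ fil K w n → D f ∈ fil K w (n + 1)

variable {w : σ → ℕ} {D : Module.End K (MvPowerSeries σ K)}

theorem Raises.neg (hD : Raises w D) : Raises w (-D) :=
  fun n f hf => neg_mem (hD n f hf)

theorem Raises.pow_mem (hD : Raises w D) {n : ℕ} {f : MvPowerSeries σ K} (hf : f ∈ fil K w n)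
    (k : ℕ) : (D ^ k) f ∈ fil K w (n + k) := by
  induction k with
  | zero => simpa using hf
  | succ k ih => rw [pow_succ', Module.End.mul_apply, ← add_assoc]; exact hD _ _ ih

/-- The truncated exponential series of an operator. -/
noncomputable def expTrunc (D : Module.End K (MvPowerSeries σ K)) (N : ℕ) : Module.End K (MvPowerSeries σ K) :=
  ∑ k ∈ Finset.range N, (k.factorial : K)⁻¹ • D ^ k

theorem expTrunc_apply (N : ℕ) (f : MvPowerSeries σ K) :
    expTrunc D N f = ∑ k ∈ Finset.range N, (k.factorial : K)⁻¹ • (D ^ k) f := by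
  simp [expTrunc, LinearMap.sum_apply]

/-- The exponential of an operator that raises the filtration `w`. -/
noncomputable def expSeries (w : σ → ℕ) (D : Module.End K (MvPowerSeries σ K)) :
    Module.End K (MvPowerSeries σ K) where
  -- `D ^ k` sends everything to weight at least `k`, so the coefficient at `d` is the same for all
  -- truncations longer than the weight of `d`.
  toFun f d := coeff d (expTrunc D (Finsupp.weight w d + 1) f)
  map_add' f g := by
    funext d
    change coeff d (expTrunc D _ (f + g)) = coeff d (expTrunc D _ f) + coeff d (expTrunc D _ g)
    rw [map_add, map_add]
  map_smul' c f := by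
    funext d
    change coeff d (expTrunc D _ (c • f)) = c * coeff d (expTrunc D _ f)
    rw [map_smul, map_smul, smul_eq_mul]

theorem coeff_expSeries (d : σ →₀ ℕ) (f : MvPowerSeries σ K) :
    coeff d (expSeries w D f) = coeff d (expTrunc D (Finsupp.weight w d + 1) f) := rfl

theorem Raises.expSeries_sub_mem (hD : Raises w D) (N : ℕ) (f : MvPowerSeries σ K) :
    expSeries w D f - expTrunc D N f ∈ fil K w N := by
  intro d hd
  rw [map_sub, coeff_expSeries, sub_eq_zero, expTrunc_apply, expTrunc_apply, map_sum, map_sum]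
  refine Finset.sum_subset (Finset.range_mono hd) fun k _ hk => ?_
  rw [Finset.mem_range, not_lt] at hk
  rw [map_smul, hD.pow_mem mem_fil_zero k d (by omega), smul_zero]

theorem Raises.expTrunc_mem (hD : Raises w D) (N : ℕ) {n : ℕ} {f : MvPowerSeries σ K}
    (hf : f ∈ fil K w n) : expTrunc D N f ∈ fil K w n := by
  rw [expTrunc_apply]
  exact sum_mem fun k _ => Submodule.smul_mem _ _ (fil_mono (by omega) (hD.pow_mem hf k))

theorem Raises.expSeries_mem (hD : Raises w D) {n : ℕ} {f : MvPowerSeries σ K}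
    (hf : f ∈ fil K w n) : expSeries w D f ∈ fil K w n := by
  have := add_mem (hD.expSeries_sub_mem n f) (hD.expTrunc_mem n hf)
  rwa [sub_add_cancel] at this

theorem Raises.expSeries_sub_self_mem (hD : Raises w D) {n : ℕ} {f : MvPowerSeries σ K}
    (hf : f ∈ fil K w n) : expSeries w D f - f ∈ fil K w (n + 1) := by
  have h1 := hD.expSeries_sub_mem (n + 1) f
  have h2 : expTrunc D (n + 1) f - f ∈ fil K w (n + 1) := by
    rw [expTrunc_apply, Finset.sum_range_succ']
    simp only [Nat.factorial_zero, Nat.cast_one, inv_one, pow_zero, Module.End.one_apply, one_smul,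
      add_sub_cancel_right]
    exact sum_mem fun k _ => Submodule.smul_mem _ _ (fil_mono (by omega) (hD.pow_mem hf (k + 1)))
  have := add_mem h1 h2
  rwa [sub_add_sub_cancel] at this

variable [CharZero K]

/-- The exponential of a derivation of a bilinear map is compatible with that map. -/
theorem Raises.expSeries_bilin (hD : Raises w D) (c : ℕ)
    (β : MvPowerSeries σ K →ₗ[K] MvPowerSeries σ K →ₗ[K] MvPowerSeries σ K)
    (hβ : ∀ n k f g, f ∈ fil K w n → g ∈ fil K w k → β f g ∈ fil K w (n + k - c))
    (h : ∀ f g, D (β f g) = β (D f) g + β f (D g)) (f g : MvPowerSeries σ K) :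
    expSeries w D (β f g) = β (expSeries w D f) (expSeries w D g) := by
  rw [← sub_eq_zero]
  refine eq_zero_of_forall_mem_fil (w := w) c fun N => ?_
  have h1 := hD.expSeries_sub_mem N (β f g)
  have hf := hD.expSeries_sub_mem N f
  have hg := hD.expSeries_sub_mem N g
  have h2 := hβ N 0 _ (expSeries w D g) hf mem_fil_zero
  have h3 := hβ 0 N (expTrunc D N f) _ mem_fil_zero hg
  -- Applying `β` to the two truncations gives a square sum, truncating the exponential of `β f g` a
  -- triangular one; the terms between them have `i + j ≥ N`, hence weight at least `N - c`.
  have h4 := sum_range_sub_sum_antidiagonal_mem (fil K w (N - c)) N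
    (fun i j => β ((i.factorial : K)⁻¹ • (D ^ i) f) ((j.factorial : K)⁻¹ • (D ^ j) g))
    fun i j hij => fil_mono (by omega) (hβ _ _ _ _
      (Submodule.smul_mem _ _ (hD.pow_mem (mem_fil_zero (f := f)) i))
      (Submodule.smul_mem _ _ (hD.pow_mem (mem_fil_zero (f := g)) j)))
  have h5 : ∑ n ∈ Finset.range N, ∑ ij ∈ Finset.HasAntidiagonal.antidiagonal n,
      β ((ij.1.factorial : K)⁻¹ • (D ^ ij.1) f) ((ij.2.factorial : K)⁻¹ • (D ^ ij.2) g)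
      = expTrunc D N (β f g) := by
    rw [expTrunc_apply]
    exact Finset.sum_congr rfl fun n _ => (iterate_leibniz_factorial β h n f g).symm
  have h6 : ∑ i ∈ Finset.range N, ∑ j ∈ Finset.range N,
      β ((i.factorial : K)⁻¹ • (D ^ i) f) ((j.factorial : K)⁻¹ • (D ^ j) g)
      = β (expTrunc D N f) (expTrunc D N g) := by
    rw [expTrunc_apply, expTrunc_apply, LinearMap.map_sum₂]
    exact Finset.sum_congr rfl fun i _ => (map_sum _ _ _).symm
  rw [h5, h6] at h4
  rw [map_sub, LinearMap.sub_apply] at h2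
  rw [map_sub] at h3
  have := sub_mem (fil_mono (Nat.sub_le N c) h1) (add_mem (add_mem (fil_mono (by omega) h2)
    (fil_mono (by omega) h3)) h4)
  convert! this using 1
  abel

omit [CharZero K] in
theorem neg_one_pow_smul_pow (k : ℕ) (f : MvPowerSeries σ K) :
    ((-D) ^ k) f = ((-1 : K) ^ k) • (D ^ k) f := by
  rw [← neg_one_smul K D, smul_pow, LinearMap.smul_apply]

/-- The coefficients of `exp (-X) * exp X = 1`. -/
theorem sum_antidiagonal_neg_one_pow_factorial (n : ℕ) :
    ∑ ij ∈ Finset.HasAntidiagonal.antidiagonal n,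
      ((ij.1.factorial : K)⁻¹ * (-1) ^ ij.1) * (ij.2.factorial : K)⁻¹ = if n = 0 then 1 else 0 := by
  have h := congrArg (PowerSeries.coeff n)
    (PowerSeries.exp_mul_exp_neg_eq_one (A := K))
  rw [mul_comm, PowerSeries.coeff_mul, PowerSeries.coeff_one] at h
  rw [← h]
  refine Finset.sum_congr rfl fun ij _ => ?_
  simp [PowerSeries.evalNegHom, PowerSeries.coeff_exp, mul_comm]

theorem Raises.expSeries_neg_apply (hD : Raises w D) (f : MvPowerSeries σ K) :
    expSeries w (-D) (expSeries w D f) = f := by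
  rw [← sub_eq_zero]
  refine eq_zero_of_forall_mem_fil (w := w) 0 fun N => ?_
  rw [Nat.sub_zero]
  obtain _ | N := N
  · exact mem_fil_zero
  have h1 := hD.neg.expSeries_mem (hD.expSeries_sub_mem (N + 1) f)
  have h2 := hD.neg.expSeries_sub_mem (N + 1) (expTrunc D (N + 1) f)
  have h4 := sum_range_sub_sum_antidiagonal_mem (fil K w (N + 1)) (N + 1)
    (fun i j => (((i.factorial : K)⁻¹ * (-1) ^ i) * (j.factorial : K)⁻¹) • (D ^ (i + j)) f)
    fun i j hij => Submodule.smul_mem _ _ (fil_mono (by omega)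
      (hD.pow_mem (mem_fil_zero (f := f)) (i + j)))
  have h5 : ∑ n ∈ Finset.range (N + 1), ∑ ij ∈ Finset.HasAntidiagonal.antidiagonal n,
      (((ij.1.factorial : K)⁻¹ * (-1) ^ ij.1) * (ij.2.factorial : K)⁻¹) • (D ^ (ij.1 + ij.2)) f
      = f := by
    have : ∀ n ∈ Finset.range (N + 1), ∑ ij ∈ Finset.HasAntidiagonal.antidiagonal n,
        (((ij.1.factorial : K)⁻¹ * (-1) ^ ij.1) * (ij.2.factorial : K)⁻¹) • (D ^ (ij.1 + ij.2)) f
        = if n = 0 then f else 0 := by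
      intro n _
      have h6 : ∀ ij ∈ Finset.HasAntidiagonal.antidiagonal n,
          (((ij.1.factorial : K)⁻¹ * (-1) ^ ij.1) * (ij.2.factorial : K)⁻¹) • (D ^ (ij.1 + ij.2)) f
          = (((ij.1.factorial : K)⁻¹ * (-1) ^ ij.1) * (ij.2.factorial : K)⁻¹) • (D ^ n) f := by
        intro ij hij
        rw [Finset.HasAntidiagonal.mem_antidiagonal.mp hij]
      rw [Finset.sum_congr rfl h6, ← Finset.sum_smul, sum_antidiagonal_neg_one_pow_factorial]
      split_ifs with hn
      · subst hn; simp
      · simp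
    rw [Finset.sum_congr rfl this]
    simp
  have h6 : ∑ i ∈ Finset.range (N + 1), ∑ j ∈ Finset.range (N + 1),
      (((i.factorial : K)⁻¹ * (-1) ^ i) * (j.factorial : K)⁻¹) • (D ^ (i + j)) f
      = expTrunc (-D) (N + 1) (expTrunc D (N + 1) f) := by
    rw [expTrunc_apply]
    refine Finset.sum_congr rfl fun i _ => ?_
    rw [neg_one_pow_smul_pow, expTrunc_apply, map_sum, Finset.smul_sum, Finset.smul_sum]
    refine Finset.sum_congr rfl fun j _ => ?_
    rw [map_smul, smul_smul, smul_smul, pow_add, Module.End.mul_apply]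
  rw [h5, h6] at h4
  rw [map_sub] at h1
  have := add_mem (add_mem h1 h2) h4
  convert! this using 1
  abel

/-- The algebra endomorphism `exp D` of a derivation `D` that raises the filtration. -/
noncomputable def expAlgHom (w : σ → ℕ) (D : Derivation K (MvPowerSeries σ K) (MvPowerSeries σ K))
    (hD : Raises w (D : Module.End K (MvPowerSeries σ K))) :
    MvPowerSeries σ K →ₐ[K] MvPowerSeries σ K :=
  AlgHom.ofLinearMap (expSeries w (D : Module.End K (MvPowerSeries σ K)))
    (by
      ext d
      rw [coeff_expSeries, expTrunc_apply, Finset.sum_range_succ',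
        Finset.sum_eq_zero fun k _ => by
          rw [pow_succ, Module.End.mul_apply, Derivation.coeFn_coe, D.map_one_eq_zero, map_zero,
            smul_zero]]
      simp)
    (fun f g => hD.expSeries_bilin 0 (LinearMap.mul K _)
      (fun n k f g hf hg => mul_mem_fil hf hg)
      (fun f g => by simp [mul_comm, add_comm]) f g)

end Exp

/-! ### Vectors on which an operator acts semisimply or nilpotently. -/

section LocalJordan

open Polynomial

variable {K U V W : Type*} [Field K] [AddCommGroup U] [Module K U] [AddCommGroup V] [Module K V]
  [AddCommGroup W] [Module K W]

/-- A linear map intertwining two operators intertwines their polynomials. -/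
theorem aeval_intertwine (f : U →ₗ[K] V) {S : Module.End K U} {T : Module.End K V}
    (h : ∀ u, f (S u) = T (f u)) (p : K[X]) (u : U) : f (aeval S p u) = aeval T p (f u) := by
  induction p using Polynomial.induction_on' generalizing u with
  | add p q hp hq => simp [hp, hq]
  | monomial n a =>
    have : ∀ n u, f ((S ^ n) u) = (T ^ n) (f u) := by
      intro n
      induction n with
      | zero => simp
      | succ n ih =>
        intro u
        rw [pow_succ, pow_succ, Module.End.mul_apply, Module.End.mul_apply, ih, h]
    simp [aeval_monomial, this, Module.algebraMap_end_apply]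

/-- The operator `S` acts semisimply on the vector `v`. -/
def LocSemisimple (S : Module.End K V) (v : V) : Prop :=
  ∃ p : K[X], Squarefree p ∧ aeval S p v = 0

/-- The operator `N` acts nilpotently on the vector `v`. -/
def LocNilpotent (N : Module.End K V) (v : V) : Prop := ∃ k : ℕ, (N ^ k) v = 0

theorem LocSemisimple.of_dvd {S : Module.End K V} {v : V} {p q : K[X]} (hpq : p ∣ q)
    (h : aeval S p v = 0) : aeval S q v = 0 := by
  obtain ⟨r, rfl⟩ := hpq
  rw [mul_comm, map_mul, Module.End.mul_apply, h, map_zero]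

/-- The radical of the product of the two annihilating polynomials is squarefree and divisible by
both. -/
theorem LocSemisimple.add {S : Module.End K V} {v v' : V} (h : LocSemisimple S v)
    (h' : LocSemisimple S v') : LocSemisimple S (v + v') := by
  obtain ⟨p, hp, hv⟩ := h
  obtain ⟨q, hq, hv'⟩ := h'
  classical
  have hpq : p * q ≠ 0 := mul_ne_zero hp.ne_zero hq.ne_zero
  refine ⟨UniqueFactorizationMonoid.radical (p * q), UniqueFactorizationMonoid.squarefree_radical,
    ?_⟩
  rw [map_add, LocSemisimple.of_dvd _ hv, LocSemisimple.of_dvd _ hv', add_zero]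
  · exact (UniqueFactorizationMonoid.dvd_radical_iff hq.isRadical hpq).2 (dvd_mul_left _ _)
  · exact (UniqueFactorizationMonoid.dvd_radical_iff hp.isRadical hpq).2 (dvd_mul_right _ _)

theorem LocSemisimple.of_eq_zero {S : Module.End K V} {v : V} (h : S v = 0) : LocSemisimple S v :=
  ⟨Polynomial.X, irreducible_X.squarefree, by simpa using h⟩

/-- The cyclic module `K[X] / (p)` maps onto the orbit of a vector killed by `p`. -/
theorem exists_cyclic_map {S : Module.End K V} {v : V} {p : K[X]} (h : aeval S p v = 0) :
    ∃ f : AdjoinRoot p →ₗ[K] V, f 1 = v ∧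
      ∀ b, f (AdjoinRoot.root p * b) = S (f b) := by
  let F : K[X] →ₗ[K[X]] Module.AEval' S :=
    LinearMap.toSpanSingleton K[X] (Module.AEval' S) (Module.AEval'.of S v)
  have hF : Ideal.span {p} ≤ LinearMap.ker F := by
    rw [Ideal.span_le, Set.singleton_subset_iff, SetLike.mem_coe, LinearMap.mem_ker]
    change p • Module.AEval'.of S v = 0
    rw [← Module.AEval.of_aeval_smul]
    change Module.AEval'.of S (aeval S p v) = 0
    rw [h, map_zero]
  refine ⟨(Module.AEval'.of S).symm.toLinearMap ∘ₗ
    (Submodule.liftQ (Ideal.span {p}) F hF).restrictScalars K, ?_, fun b => ?_⟩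
  · change (Module.AEval'.of S).symm ((1 : K[X]) • Module.AEval'.of S v) = v
    rw [one_smul, LinearEquiv.symm_apply_apply]
  · obtain ⟨b, rfl⟩ := Ideal.Quotient.mk_surjective b
    change (Module.AEval'.of S).symm ((Polynomial.X * b : K[X]) • Module.AEval'.of S v)
      = S ((Module.AEval'.of S).symm (b • Module.AEval'.of S v))
    rw [mul_smul]
    exact Module.AEval.of_symm_X_smul _ _

/-- Multiplications by `x ⊗ 1` and `1 ⊗ y` are commuting semisimple operators, so over a perfect
field their sum is semisimple; its minimal polynomial serves as `r` because the regular
representation is faithful. -/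
theorem exists_squarefree_aeval_tensor [PerfectField K] {A B : Type*} [CommRing A] [Algebra K A]
    [CommRing B] [Algebra K B] [Module.Finite K A] [Module.Finite K B] {x : A} {y : B} {p q : K[X]}
    (hp : Squarefree p) (hq : Squarefree q) (hx : aeval x p = 0) (hy : aeval y q = 0) :
    ∃ r : K[X], Squarefree r ∧ aeval (x ⊗ₜ[K] (1 : B) + (1 : A) ⊗ₜ[K] y) r = 0 := by
  have ha : aeval (x ⊗ₜ[K] (1 : B)) p = 0 := by
    have : x ⊗ₜ[K] (1 : B) = Algebra.TensorProduct.includeLeft (R := K) (S := K) (B := B) x := rfl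
    rw [this, aeval_algHom_apply, hx, map_zero]
  have hb : aeval ((1 : A) ⊗ₜ[K] y) q = 0 := by
    have : (1 : A) ⊗ₜ[K] y = Algebra.TensorProduct.includeRight (R := K) (A := A) y := rfl
    rw [this, aeval_algHom_apply, hy, map_zero]
  have hla : Module.End.IsSemisimple (Algebra.lmul K (TensorProduct K A B) (x ⊗ₜ[K] (1 : B))) :=
    Module.End.isSemisimple_of_squarefree_aeval_eq_zero hp (by
      rw [aeval_algHom_apply, ha, map_zero])
  have hlb : Module.End.IsSemisimple (Algebra.lmul K (TensorProduct K A B) ((1 : A) ⊗ₜ[K] y)) :=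
    Module.End.isSemisimple_of_squarefree_aeval_eq_zero hq (by
      rw [aeval_algHom_apply, hb, map_zero])
  have hab := hla.add_of_commute ((Commute.all _ _).map (Algebra.lmul K (TensorProduct K A B))) hlb
  rw [← map_add] at hab
  refine ⟨_, hab.minpoly_squarefree, ?_⟩
  have h := minpoly.aeval K (Algebra.lmul K (TensorProduct K A B) (x ⊗ₜ[K] 1 + 1 ⊗ₜ[K] y))
  rw [aeval_algHom_apply] at h
  exact Algebra.lmul_injective (h.trans (map_zero _).symm)

/-- The map `A ⊗ B → W` induced by `β`, `f`, `g` intertwines multiplication by `x ⊗ 1 + 1 ⊗ y` with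
`SW` and sends `1` to `β (f 1) (g 1)`. -/
theorem LocSemisimple.of_cyclic_maps [PerfectField K] (β : U →ₗ[K] V →ₗ[K] W)
    {SU : Module.End K U} {SV : Module.End K V} {SW : Module.End K W}
    (h : ∀ u v, SW (β u v) = β (SU u) v + β u (SV v)) {A B : Type*} [CommRing A] [Algebra K A]
    [CommRing B] [Algebra K B] [Module.Finite K A] [Module.Finite K B] {x : A} {y : B} {p q : K[X]}
    (hp : Squarefree p) (hq : Squarefree q) (hx : aeval x p = 0) (hy : aeval y q = 0)
    {f : A →ₗ[K] U} {g : B →ₗ[K] V} (hf : ∀ a, f (x * a) = SU (f a))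
    (hg : ∀ b, g (y * b) = SV (g b)) : LocSemisimple SW (β (f 1) (g 1)) := by
  obtain ⟨r, hr, hr0⟩ := exists_squarefree_aeval_tensor hp hq hx hy
  refine ⟨r, hr, ?_⟩
  let m : TensorProduct K A B →ₗ[K] W := TensorProduct.lift (β.compl₁₂ f g)
  have hm : ∀ t, m (Algebra.lmul K (TensorProduct K A B) (x ⊗ₜ[K] 1 + 1 ⊗ₜ[K] y) t)
      = SW (m t) := by
    intro t
    induction t using TensorProduct.induction_on with
    | zero => simp only [map_zero]
    | add s t hs ht => simp only [map_add] at hs ht ⊢; rw [hs, ht]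
    | tmul s t =>
      have h1 : Algebra.lmul K (TensorProduct K A B) (x ⊗ₜ[K] 1 + 1 ⊗ₜ[K] y) (s ⊗ₜ[K] t)
          = (x * s) ⊗ₜ[K] t + s ⊗ₜ[K] (y * t) := by
        simp
      rw [h1, map_add]
      simp only [m, TensorProduct.lift.tmul, LinearMap.compl₁₂_apply]
      rw [h, hf, hg]
  have h1 : m 1 = β (f 1) (g 1) := by
    rw [Algebra.TensorProduct.one_def]
    simp only [m, TensorProduct.lift.tmul, LinearMap.compl₁₂_apply]
  rw [← h1, ← aeval_intertwine m hm, aeval_algHom_apply, hr0, map_zero, LinearMap.zero_apply,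
    map_zero]

/-- Replaces "eigenvalues add" without enlarging the field: the orbits of `u` and `v` are images of
the algebras `K[X]/(p)` and `K[X]/(q)`. -/
theorem LocSemisimple.bilin [PerfectField K] (β : U →ₗ[K] V →ₗ[K] W) {SU : Module.End K U}
    {SV : Module.End K V} {SW : Module.End K W}
    (h : ∀ u v, SW (β u v) = β (SU u) v + β u (SV v)) {u : U} {v : V} (hu : LocSemisimple SU u)
    (hv : LocSemisimple SV v) : LocSemisimple SW (β u v) := by
  obtain ⟨p, hp, hpu⟩ := hu
  obtain ⟨q, hq, hqv⟩ := hv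
  obtain ⟨f, rfl, hf⟩ := exists_cyclic_map hpu
  obtain ⟨g, rfl, hg⟩ := exists_cyclic_map hqv
  have : Module.Finite K (AdjoinRoot p) := (AdjoinRoot.powerBasis hp.ne_zero).finite
  have : Module.Finite K (AdjoinRoot q) := (AdjoinRoot.powerBasis hq.ne_zero).finite
  have hx : aeval (AdjoinRoot.root p) p = 0 := AdjoinRoot.aeval_eq p ▸ AdjoinRoot.mk_self
  have hy : aeval (AdjoinRoot.root q) q = 0 := AdjoinRoot.aeval_eq q ▸ AdjoinRoot.mk_self
  exact LocSemisimple.of_cyclic_maps β h hp hq hx hy hf hg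

theorem LocNilpotent.of_le {N : Module.End K V} {v : V} {k n : ℕ} (hkn : k ≤ n)
    (h : (N ^ k) v = 0) : (N ^ n) v = 0 := by
  obtain ⟨j, rfl⟩ := Nat.exists_eq_add_of_le' hkn
  rw [pow_add, Module.End.mul_apply, h, map_zero]

theorem LocNilpotent.add {N : Module.End K V} {v v' : V} (h : LocNilpotent N v)
    (h' : LocNilpotent N v') : LocNilpotent N (v + v') := by
  obtain ⟨k, hk⟩ := h
  obtain ⟨k', hk'⟩ := h'
  exact ⟨max k k', by rw [map_add, of_le (le_max_left _ _) hk, of_le (le_max_right _ _) hk',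
    add_zero]⟩

theorem LocNilpotent.bilin (β : U →ₗ[K] V →ₗ[K] W) {NU : Module.End K U}
    {NV : Module.End K V} {NW : Module.End K W}
    (h : ∀ u v, NW (β u v) = β (NU u) v + β u (NV v)) {u : U} {v : V} (hu : LocNilpotent NU u)
    (hv : LocNilpotent NV v) : LocNilpotent NW (β u v) := by
  obtain ⟨k, hk⟩ := hu
  obtain ⟨j, hj⟩ := hv
  refine ⟨k + j, ?_⟩
  rw [iterate_leibniz β h]
  refine Finset.sum_eq_zero fun ij hij => ?_
  rw [Finset.HasAntidiagonal.mem_antidiagonal] at hij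
  rcases le_or_gt k ij.1 with h1 | h1
  · rw [of_le h1 hk, map_zero, LinearMap.zero_apply, smul_zero]
  · rw [of_le (show j ≤ ij.2 by omega) hj, map_zero, smul_zero]

/-- A squarefree polynomial contains the factor `X` at most once; `q` is what remains after removing
it. -/
theorem LocSemisimple.exists_coprime {S : Module.End K V} {v : V} (h : LocSemisimple S v) :
    ∃ q : K[X], IsCoprime Polynomial.X q ∧ S (aeval S q v) = 0 := by
  obtain ⟨p, hp, hv⟩ := h
  by_cases hX : Polynomial.X ∣ p
  · obtain ⟨q, rfl⟩ := hX
    refine ⟨q, (irreducible_X.coprime_iff_not_dvd).2 fun hq => ?_, by simpa using hv⟩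
    exact irreducible_X.not_isUnit (hp Polynomial.X (mul_dvd_mul_left Polynomial.X hq))
  · exact ⟨p, (irreducible_X.coprime_iff_not_dvd).2 hX, by rw [hv, map_zero]⟩

theorem aeval_mem_of_stable {M : Submodule K V} {S : Module.End K V} (hS : ∀ v ∈ M, S v ∈ M)
    (p : K[X]) {v : V} (hv : v ∈ M) : aeval S p v ∈ M := by
  have := aeval_intertwine M.subtype (S := S.restrict hS) (T := S) (fun _ => rfl) p ⟨v, hv⟩
  exact this ▸ Subtype.property _

theorem aeval_commute_apply {S N : Module.End K V} (hSN : Commute S N) (p : K[X]) (v : V) :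
    aeval S p (N v) = N (aeval S p v) :=
  (aeval_intertwine N (S := S) (T := S) (fun u => (LinearMap.congr_fun hSN.eq u).symm) p v).symm

theorem aeval_comm_apply (S : Module.End K V) (p q : K[X]) (v : V) :
    aeval S p (aeval S q v) = aeval S q (aeval S p v) := by
  rw [← Module.End.mul_apply, ← Module.End.mul_apply, ← map_mul, ← map_mul, mul_comm]

/-- A vector on which `S` acts invertibly and `N` nilpotently is in the image of `S + N`. -/
theorem exists_apply_eq_of_coprime {M : Submodule K V} {S N : Module.End K V}
    (hSN : Commute S N) (hS : ∀ v ∈ M, S v ∈ M) (hN : ∀ v ∈ M, N v ∈ M) {q : K[X]}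
    (hq : IsCoprime Polynomial.X q) (k : ℕ) (v : V) (hv : v ∈ M) (hqv : aeval S q v = 0)
    (hk : (N ^ k) v = 0) : ∃ u ∈ M, (S + N) u = v := by
  obtain ⟨α, β, hαβ⟩ := hq
  induction k generalizing v with
  | zero =>
    exact ⟨0, M.zero_mem, by simpa using hk.symm⟩
  | succ k ih =>
    -- Since `q(S)` kills `v`, the Bézout identity makes `α(S)` an inverse of `S` on `v`.
    have hinv : S (aeval S α v) = v := by
      have h1 := congrArg (fun r => aeval S r v) hαβ
      simp only [map_add, map_mul, aeval_X, map_one, LinearMap.add_apply, Module.End.mul_apply,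
        Module.End.one_apply, hqv, map_zero, add_zero] at h1
      rw [← aeval_commute_apply (Commute.refl S), h1]
    have hαM := aeval_mem_of_stable hS α hv
    -- With `v' = α(S) v`, applying `S + N` to `v'` overshoots `v` by `N v'`, which a smaller power
    -- of `N` kills; induction corrects it.
    obtain ⟨u, huM, hu⟩ := ih (N (aeval S α v)) (hN _ hαM)
      (by rw [aeval_commute_apply hSN, aeval_comm_apply, hqv, map_zero, map_zero])
      (by
        rw [← Module.End.mul_apply, ← pow_succ,
          ← aeval_commute_apply (hSN.pow_right (k + 1)), hk, map_zero])
    refine ⟨aeval S α v - u, sub_mem hαM huM, ?_⟩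
    rw [map_sub, hu, LinearMap.add_apply, hinv, add_sub_cancel_right]

/-- If `S` acts semisimply and `N` nilpotently, then every vector is the sum of an element of the
kernel of `S` and one of the image of `S + N`. -/
theorem exists_ker_add_range {M : Submodule K V} {S N : Module.End K V}
    (hSN : Commute S N) (hS : ∀ v ∈ M, S v ∈ M) (hN : ∀ v ∈ M, N v ∈ M) {v : V} (hv : v ∈ M)
    (hsv : LocSemisimple S v) (hnv : LocNilpotent N v) :
    ∃ r ∈ M, ∃ u ∈ M, S r = 0 ∧ v = r + (S + N) u := by
  obtain ⟨q, hq, hqv⟩ := hsv.exists_coprime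
  obtain ⟨k, hk⟩ := hnv
  obtain ⟨α, β, hαβ⟩ := id hq
  have h1 := congrArg (fun r => aeval S r v) hαβ
  simp only [map_add, map_mul, aeval_X, map_one, LinearMap.add_apply, Module.End.mul_apply,
    Module.End.one_apply] at h1
  -- In the Bézout decomposition `v = α(S) S v + β(S) q(S) v` the second term lies in `ker S`, and
  -- the first is killed by `q(S)`, so it lies in the image of `S + N`.
  obtain ⟨u, huM, hu⟩ := exists_apply_eq_of_coprime hSN hS hN hq k (aeval S α (S v))
    (aeval_mem_of_stable hS α (hS v hv))
    (by rw [aeval_comm_apply, aeval_commute_apply (Commute.refl S), hqv, map_zero])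
    (by
      rw [← aeval_commute_apply (hSN.pow_right k), ← Module.End.mul_apply (N ^ k),
        ← (hSN.pow_right k).eq, Module.End.mul_apply, hk, map_zero, map_zero])
  refine ⟨aeval S β (aeval S q v), aeval_mem_of_stable hS β (aeval_mem_of_stable hS q hv), u, huM,
    ?_, ?_⟩
  · rw [← aeval_commute_apply (Commute.refl S), hqv, map_zero]
  · rw [hu, add_comm, h1]

/-- If `S` acts semisimply and `N` nilpotently on a vector of the kernel of `S + N`, then this
vector is in the kernel of `S`. -/
theorem apply_eq_zero_of_add_apply_eq_zero {S N : Module.End K V} (hSN : Commute S N) {v : V}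
    (hsv : LocSemisimple S v) (hnv : LocNilpotent N v) (h : (S + N) v = 0) : S v = 0 := by
  obtain ⟨q, hq, hqv⟩ := hsv.exists_coprime
  obtain ⟨k, hk⟩ := hnv
  have h0 : S v = -N v := eq_neg_of_add_eq_zero_left h
  -- On `v` the operators `S` and `-N` agree, so some power `S ^ k` kills `v`; as `X ^ k` and `q`
  -- are coprime and `S q(S) v = 0`, this forces `S v = 0`.
  have hpow : ∀ j, (S ^ j) v = (-1 : K) ^ j • (N ^ j) v := by
    intro j
    induction j with
    | zero => simp
    | succ j ih =>
      rw [pow_succ', Module.End.mul_apply, ih, map_smul, ← Module.End.mul_apply,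
        (hSN.pow_right j).eq, Module.End.mul_apply, h0, map_neg, ← Module.End.mul_apply, ← pow_succ,
        pow_succ (-1 : K), mul_neg_one, neg_smul, smul_neg]
  obtain ⟨α, β, hαβ⟩ := (hq.pow_left (m := k))
  have h1 := congrArg (fun r => S (aeval S r v)) hαβ
  simp only [map_add, map_mul, aeval_X, map_pow, map_one, LinearMap.add_apply,
    Module.End.mul_apply, Module.End.one_apply] at h1
  rw [hpow, hk, smul_zero, map_zero, map_zero, zero_add,
    ← aeval_commute_apply (Commute.refl S), hqv, map_zero] at h1
  exact h1.symm

end LocalJordan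

/-! ### The Poisson bracket: weights, brackets of coordinates, Jacobi identity. -/

section Bracket

/-- The weights of the coordinates: `1` for `xᵢ` and `yᵢ`, and `2` for `zⱼ`. -/
def wt {l m : ℕ} : Coord l m → ℕ := Sum.elim (fun _ => 1) (Sum.elim (fun _ => 1) fun _ => 2)

variable {l m : ℕ}

@[simp] theorem wt_x (i : Fin l) : wt (Coord.x i : Coord l m) = 1 := rfl
@[simp] theorem wt_y (i : Fin l) : wt (Coord.y i : Coord l m) = 1 := rfl
@[simp] theorem wt_z (i : Fin m) : wt (Coord.z i : Coord l m) = 2 := rfl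

theorem one_le_wt (a : Coord l m) : 1 ≤ wt a := by
  rcases a with i | i | i <;> simp [wt]

theorem wt_le_two (a : Coord l m) : wt a ≤ 2 := by
  rcases a with i | i | i <;> simp [wt]

variable {𝕜 : Type*} [Field 𝕜]

theorem derivation_sum_apply {A ι : Type*} [CommRing A] [Algebra 𝕜 A] (s : Finset ι)
    (D : ι → Derivation 𝕜 A A) (f : A) : (∑ i ∈ s, D i) f = ∑ i ∈ s, D i f := by
  exact (congrFun (map_sum (Derivation.coeFnAddMonoidHom : Derivation 𝕜 A A →+ (A → A)) D s) f).trans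
    (Finset.sum_apply _ _ _)

/-- A formal vector field as a derivation. -/
noncomputable def vfDerivation (V : FormalVF 𝕜 l m) :
    Derivation 𝕜 (FormalFn 𝕜 l m) (FormalFn 𝕜 l m) :=
  ∑ a, V a • pderiv 𝕜 a

theorem vfDerivation_apply (V : FormalVF 𝕜 l m) (f : FormalFn 𝕜 l m) :
    vfDerivation V f = V.deriv f := by
  simp [vfDerivation, FormalVF.deriv, derivation_sum_apply]

theorem vfDerivation_X (V : FormalVF 𝕜 l m) (b : Coord l m) : vfDerivation V (X b) = V b := by
  classical
  rw [vfDerivation_apply, FormalVF.deriv, Finset.sum_eq_single b]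
  · rw [pderiv_X_self, mul_one]
  · intro a _ hab
    rw [pderiv_X_of_ne hab.symm, mul_zero]
  · simp

theorem vfDerivation_mem_fil (V : FormalVF 𝕜 l m) {n k : ℕ} (hV : ∀ a, V a ∈ fil 𝕜 wt (wt a + k))
    {f : FormalFn 𝕜 l m} (hf : f ∈ fil 𝕜 wt n) : vfDerivation V f ∈ fil 𝕜 wt (n + k) := by
  rw [vfDerivation_apply]
  exact sum_mem fun a _ => fil_mono (by omega) (mul_mem_fil (hV a) (pderiv_mem_fil a hf))

theorem vfDerivation_mem_fil_sub_two (V : FormalVF 𝕜 l m) {n : ℕ}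
    {f : FormalFn 𝕜 l m} (hf : f ∈ fil 𝕜 wt n) : vfDerivation V f ∈ fil 𝕜 wt (n - 2) := by
  rw [vfDerivation_apply]
  refine sum_mem fun a _ => fil_mono ?_ (mul_mem_fil mem_fil_zero (pderiv_mem_fil a hf))
  have := wt_le_two a
  omega

/-- A derivation is determined by its values on the coordinates. -/
theorem derivation_eq_vfDerivation {D : Derivation 𝕜 (FormalFn 𝕜 l m) (FormalFn 𝕜 l m)} {c : ℕ}
    (hD : ∀ n f, f ∈ fil 𝕜 wt n → D f ∈ fil 𝕜 wt (n - c)) : D = vfDerivation fun a => D (X a) :=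
  derivation_ext_of_fil one_le_wt (c + 2) (fun n f hf => fil_mono (by omega) (hD n f hf))
    (fun n f hf => fil_mono (by omega) (vfDerivation_mem_fil_sub_two _ hf))
    fun a => (vfDerivation_X (fun a => D (X a)) a).symm

variable {𝔤 : Type*} [LieRing 𝔤] [LieAlgebra 𝕜 𝔤] (e : Module.Basis (Fin m) 𝕜 𝔤)

theorem bracket_skew (f g : FormalFn 𝕜 l m) : bracket e g f = -bracket e f g := by
  unfold bracket
  rw [neg_add, ← Finset.sum_neg_distrib, ← mul_neg, ← Finset.sum_neg_distrib]
  congr 1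
  · exact Finset.sum_congr rfl fun i _ => by ring
  · congr 1
    refine Finset.sum_congr rfl fun i _ => ?_
    rw [← Finset.sum_neg_distrib]
    refine Finset.sum_congr rfl fun j _ => ?_
    rw [← Finset.sum_neg_distrib]
    exact Finset.sum_congr rfl fun k _ => by ring

/-- The Hamiltonian derivation `{f, ·}`. -/
noncomputable def ham (f : FormalFn 𝕜 l m) :
    Derivation 𝕜 (FormalFn 𝕜 l m) (FormalFn 𝕜 l m) :=
  (∑ i : Fin l, (pderiv 𝕜 (Coord.x i) f • pderiv 𝕜 (Coord.y i)
      - pderiv 𝕜 (Coord.y i) f • pderiv 𝕜 (Coord.x i)))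
  + (C (1 / 2 : 𝕜) : FormalFn 𝕜 l m) • ∑ i : Fin m, ∑ j : Fin m, ∑ k : Fin m,
      (C (structConst e i j k) * X (Coord.z k) : FormalFn 𝕜 l m) •
        (pderiv 𝕜 (Coord.z i) f • pderiv 𝕜 (Coord.z j)
          - pderiv 𝕜 (Coord.z j) f • pderiv 𝕜 (Coord.z i))

theorem ham_apply (f g : FormalFn 𝕜 l m) : ham e f g = bracket e f g := by
  simp [ham, bracket, derivation_sum_apply]

theorem ham_skew (f g : FormalFn 𝕜 l m) : ham e g f = -ham e f g := by
  rw [ham_apply, ham_apply, bracket_skew]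

/-- The `x, y` terms differentiate twice at cost 1 each; the `z` terms differentiate twice at cost 2
each and regain 2 from the factor `zₖ`. -/
theorem bracket_mem_fil {f g : FormalFn 𝕜 l m} {n k : ℕ} (hf : f ∈ fil 𝕜 wt n)
    (hg : g ∈ fil 𝕜 wt k) : bracket e f g ∈ fil 𝕜 wt (n + k - 2) := by
  have h : ∀ a b, pderiv 𝕜 a f * pderiv 𝕜 b g ∈ fil 𝕜 wt ((n - wt a) + (k - wt b)) :=
    fun a b => mul_mem_fil (pderiv_mem_fil a hf) (pderiv_mem_fil b hg)
  refine add_mem (sum_mem fun i _ => sub_mem (fil_mono ?_ (h _ _)) (fil_mono ?_ (h _ _)))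
    (C_mul_mem_fil _ (sum_mem fun i _ => sum_mem fun j _ => sum_mem fun k _ => ?_))
  · simp only [wt_x, wt_y]; omega
  · simp only [wt_x, wt_y]; omega
  · refine fil_mono ?_ (mul_mem_fil (C_mul_mem_fil _ (X_mem_fil _))
      (sub_mem (h (Coord.z i) (Coord.z j)) (h (Coord.z j) (Coord.z i))))
    simp only [wt_z]; omega

theorem ham_mem_fil {f g : FormalFn 𝕜 l m} {n k : ℕ} (hf : f ∈ fil 𝕜 wt n)
    (hg : g ∈ fil 𝕜 wt k) : ham e f g ∈ fil 𝕜 wt (n + k - 2) := by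
  rw [ham_apply]; exact bracket_mem_fil e hf hg

theorem ham_lowers (f : FormalFn 𝕜 l m) (n : ℕ) (g : FormalFn 𝕜 l m) (hg : g ∈ fil 𝕜 wt n) :
    ham e f g ∈ fil 𝕜 wt (n - 2) :=
  fil_mono (by omega) (ham_mem_fil e mem_fil_zero hg)

theorem ham_eq_vfDerivation (f : FormalFn 𝕜 l m) : ham e f = vfDerivation (hamVF e f) := by
  rw [derivation_eq_vfDerivation (ham_lowers e f)]
  exact congrArg _ (funext fun a => ham_apply e f (X a))

theorem hamVF_deriv (f g : FormalFn 𝕜 l m) : (hamVF e f).deriv g = bracket e f g := by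
  rw [← vfDerivation_apply, ← ham_eq_vfDerivation, ham_apply]

/-- The Poisson bracket as a bilinear map. -/
noncomputable def bracketBilin : FormalFn 𝕜 l m →ₗ[𝕜] FormalFn 𝕜 l m →ₗ[𝕜] FormalFn 𝕜 l m :=
  LinearMap.mk₂ 𝕜 (fun f g => ham e f g)
    (fun f f' g => by rw [ham_skew, map_add, ham_skew e f, ham_skew e f']; abel)
    (fun c f g => by
      rw [ham_skew, Derivation.map_smul, ham_skew e f, smul_neg, neg_neg])
    (fun f g g' => map_add _ _ _) (fun c f g => Derivation.map_smul _ _ _)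

theorem bracketBilin_apply (f g : FormalFn 𝕜 l m) : bracketBilin e f g = ham e f g := rfl

theorem ham_sub (f g : FormalFn 𝕜 l m) : ham e (f - g) = ham e f - ham e g :=
  Derivation.ext fun h => LinearMap.congr_fun (map_sub (bracketBilin e) f g) h

theorem ham_C (c : 𝕜) : ham e (C c : FormalFn 𝕜 l m) = 0 := by
  refine Derivation.ext fun h => ?_
  rw [ham_skew, show (C c : FormalFn 𝕜 l m) = algebraMap 𝕜 _ c from rfl, Derivation.map_algebraMap]
  simp

theorem ham_x (i : Fin l) (g : FormalFn 𝕜 l m) :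
    ham e (X (Coord.x i)) g = pderiv 𝕜 (Coord.y i) g := by
  classical
  simp [ham_apply, bracket, pderiv_X, Pi.single_apply]

theorem ham_y (i : Fin l) (g : FormalFn 𝕜 l m) :
    ham e (X (Coord.y i)) g = -pderiv 𝕜 (Coord.x i) g := by
  classical
  simp [ham_apply, bracket, pderiv_X, Pi.single_apply]

theorem structConst_skew (i j k : Fin m) : structConst e j i k = -structConst e i j k := by
  rw [structConst, structConst, ← lie_skew, map_neg, Finsupp.neg_apply]

/-- The index `i` can occur in either slot of the double sum; by skew-symmetry of the structure
constants both cases contribute equally, which cancels the factor `1/2`. -/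
theorem ham_z [CharZero 𝕜] (i : Fin m) (g : FormalFn 𝕜 l m) : ham e (X (Coord.z i)) g =
    ∑ j, (∑ k, C (structConst e i j k) * X (Coord.z k)) * pderiv 𝕜 (Coord.z j) g := by
  classical
  have h1 : ∀ a b : Fin m, pderiv 𝕜 (Coord.z a) (X (Coord.z b) : FormalFn 𝕜 l m)
      = if a = b then 1 else 0 := by
    intro a b
    split_ifs with h
    · rw [h, pderiv_X_self]
    · exact pderiv_X_of_ne (by simpa using Ne.symm h)
  have h2 : ∀ b : Fin l, pderiv 𝕜 (Coord.x b) (X (Coord.z i) : FormalFn 𝕜 l m) = 0 :=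
    fun b => pderiv_X_of_ne (by simp)
  have h3 : ∀ b : Fin l, pderiv 𝕜 (Coord.y b) (X (Coord.z i) : FormalFn 𝕜 l m) = 0 :=
    fun b => pderiv_X_of_ne (by simp)
  rw [ham_apply, bracket]
  simp only [h1, h2, h3, zero_mul, sub_zero, Finset.sum_const_zero, zero_add, ite_mul, one_mul,
    mul_sub, mul_ite, mul_zero, Finset.sum_sub_distrib]
  have h4 : ∑ a : Fin m, ∑ b : Fin m, ∑ k : Fin m, (if a = i then
      C (structConst e a b k) * X (Coord.z k) * pderiv 𝕜 (Coord.z b) g else 0)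
      = ∑ j, (∑ k, C (structConst e i j k) * X (Coord.z k)) * pderiv 𝕜 (Coord.z j) g := by
    rw [Finset.sum_eq_single i]
    · simp only [if_true, Finset.sum_mul]
    · intro b _ hb; simp [hb]
    · simp
  have h5 : ∑ a : Fin m, ∑ b : Fin m, ∑ k : Fin m, (if b = i then
      C (structConst e a b k) * X (Coord.z k) * pderiv 𝕜 (Coord.z a) g else 0)
      = -∑ j, (∑ k, C (structConst e i j k) * X (Coord.z k)) * pderiv 𝕜 (Coord.z j) g := by
    rw [← Finset.sum_neg_distrib]
    refine Finset.sum_congr rfl fun a _ => ?_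
    rw [Finset.sum_eq_single i]
    · simp only [if_true, Finset.sum_mul, ← Finset.sum_neg_distrib]
      refine Finset.sum_congr rfl fun k _ => ?_
      rw [structConst_skew, map_neg, neg_mul, neg_mul]
    · intro b _ hb; simp [hb]
    · simp
  rw [h4, h5, mul_neg, sub_neg_eq_add, ← add_mul, ← map_add, add_halves, map_one, one_mul]

theorem ham_x_x (i j : Fin l) : ham e (X (Coord.x i) : FormalFn 𝕜 l m) (X (Coord.x j)) = 0 := by
  rw [ham_x]; exact pderiv_X_of_ne (by simp)

theorem ham_y_y (i j : Fin l) : ham e (X (Coord.y i) : FormalFn 𝕜 l m) (X (Coord.y j)) = 0 := by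
  rw [ham_y, pderiv_X_of_ne (by simp), neg_zero]

theorem ham_x_y (i j : Fin l) :
    ham e (X (Coord.x i) : FormalFn 𝕜 l m) (X (Coord.y j)) = if i = j then 1 else 0 := by
  rw [ham_x]
  split_ifs with h
  · subst h; exact pderiv_X_self
  · exact pderiv_X_of_ne (by simpa using Ne.symm h)

theorem ham_x_z (i : Fin l) (j : Fin m) :
    ham e (X (Coord.x i) : FormalFn 𝕜 l m) (X (Coord.z j)) = 0 := by
  rw [ham_x]; exact pderiv_X_of_ne (by simp)

theorem ham_y_z (i : Fin l) (j : Fin m) :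
    ham e (X (Coord.y i) : FormalFn 𝕜 l m) (X (Coord.z j)) = 0 := by
  rw [ham_y, pderiv_X_of_ne (by simp), neg_zero]

theorem ham_z_z [CharZero 𝕜] (i j : Fin m) : ham e (X (Coord.z i) : FormalFn 𝕜 l m) (X (Coord.z j)) =
    ∑ k, C (structConst e i j k) * X (Coord.z k) := by
  rw [ham_z, Finset.sum_eq_single j]
  · rw [pderiv_X_self, mul_one]
  · intro b _ hb
    rw [pderiv_X_of_ne (by simpa using hb.symm), mul_zero]
  · simp

/-- The linear functions `∑ vₐ uₐ`. -/
noncomputable def linFn : (Coord l m → 𝕜) →ₗ[𝕜] FormalFn 𝕜 l m where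
  toFun v := ∑ a, C (v a) * X a
  map_add' v v' := by simp [add_mul, Finset.sum_add_distrib]
  map_smul' c v := by
    simp [Finset.smul_sum, smul_eq_C_mul, mul_assoc]

/-- The linear function on `𝔤*` given by an element of `𝔤`. -/
noncomputable def lieFn : 𝔤 →ₗ[𝕜] FormalFn 𝕜 l m where
  toFun v := ∑ k, C (e.repr v k) * X (Coord.z k)
  map_add' v v' := by simp [add_mul, Finset.sum_add_distrib]
  map_smul' c v := by
    simp [Finset.smul_sum, smul_eq_C_mul, mul_assoc]

theorem lieFn_basis (i : Fin m) : lieFn e (e i) = (X (Coord.z i) : FormalFn 𝕜 l m) := by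
  simp [lieFn, Finsupp.single_apply, apply_ite, ite_mul]

/-- The Lie bracket of `𝔤` as a bilinear map. -/
def lieBilin (𝕜 𝔤 : Type*) [CommRing 𝕜] [LieRing 𝔤] [LieAlgebra 𝕜 𝔤] : 𝔤 →ₗ[𝕜] 𝔤 →ₗ[𝕜] 𝔤 :=
  LinearMap.mk₂ 𝕜 (fun u v => ⁅u, v⁆) add_lie smul_lie lie_add fun c u v => lie_smul c u v

theorem lieBilin_apply (u v : 𝔤) : lieBilin 𝕜 𝔤 u v = ⁅u, v⁆ := rfl

theorem ham_lieFn [CharZero 𝕜] (u v : 𝔤) :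
    ham e (lieFn e u : FormalFn 𝕜 l m) (lieFn e v) = lieFn e ⁅u, v⁆ := by
  have h : (bracketBilin e).compl₁₂ (lieFn e) (lieFn e)
      = (lieBilin 𝕜 𝔤).compr₂ (lieFn e : 𝔤 →ₗ[𝕜] FormalFn 𝕜 l m) := by
    refine e.ext fun i => e.ext fun j => ?_
    simp only [LinearMap.compl₁₂_apply, bracketBilin_apply, LinearMap.compr₂_apply]
    rw [lieFn_basis, lieFn_basis, ham_z_z]
    rfl
  exact LinearMap.congr_fun₂ h u v

/-- The Jacobiator as a derivation. -/
noncomputable def jacobiator (f g : FormalFn 𝕜 l m) :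
    Derivation 𝕜 (FormalFn 𝕜 l m) (FormalFn 𝕜 l m) :=
  ⁅ham e f, ham e g⁆ - ham e (ham e f g)

theorem jacobiator_apply (f g h : FormalFn 𝕜 l m) : jacobiator e f g h =
    ham e f (ham e g h) - ham e g (ham e f h) - ham e (ham e f g) h := by
  rw [jacobiator, Derivation.sub_apply, Derivation.commutator_apply]

/-- Skew-symmetry alone gives this. It lets vanishing on coordinates be extended to arbitrary series
one argument at a time, since the Jacobiator is visibly a derivation only in its last argument. -/
theorem jacobiator_cyclic (f g h : FormalFn 𝕜 l m) : jacobiator e f g h = jacobiator e g h f := by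
  rw [jacobiator_apply, jacobiator_apply, ham_skew e f h, ham_skew e (ham e g h) f,
    ham_skew e h (ham e f g), ham_skew e f g, map_neg, map_neg]
  abel

theorem jacobiator_eq_zero {f g : FormalFn 𝕜 l m} (h : ∀ a, jacobiator e f g (X a) = 0) :
    jacobiator e f g = 0 := by
  refine derivation_ext_of_fil one_le_wt 4 (fun n k hk => ?_) (fun n k _ => ?_) h
  · rw [jacobiator_apply]
    exact sub_mem (sub_mem (fil_mono (by omega) (ham_lowers e _ _ _ (ham_lowers e _ _ _ hk)))
      (fil_mono (by omega) (ham_lowers e _ _ _ (ham_lowers e _ _ _ hk))))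
      (fil_mono (by omega) (ham_lowers e _ _ _ hk))
  · exact zero_mem _

/-- Constants are central, so this settles every Jacobi identity on coordinates involving some `xᵢ`
or `yᵢ`; only triples of `zⱼ` need the Jacobi identity of `𝔤`. -/
theorem ham_X_X_eq_C {a b : Coord l m} (ha : wt a = 1) :
    ∃ c : 𝕜, ham e (X a : FormalFn 𝕜 l m) (X b) = C c := by
  rcases a with i | i | i
  · rcases b with j | j | j
    · exact ⟨0, by rw [ham_x_x, map_zero]⟩
    · exact ⟨if i = j then 1 else 0, by rw [ham_x_y]; split_ifs <;> simp⟩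
    · exact ⟨0, by rw [ham_x_z, map_zero]⟩
  · rcases b with j | j | j
    · exact ⟨-if j = i then 1 else 0, by
        rw [ham_skew, ham_x_y]; split_ifs <;> simp⟩
    · exact ⟨0, by rw [ham_y_y, map_zero]⟩
    · exact ⟨0, by rw [ham_y_z, map_zero]⟩
  · simp at ha

theorem ham_apply_C (f : FormalFn 𝕜 l m) (c : 𝕜) : ham e f (C c) = 0 := by
  rw [ham_skew, ham_C, Derivation.zero_apply, neg_zero]

theorem ham_X_lieFn {a : Coord l m} (ha : wt a = 1) (v : 𝔤) :
    ham e (X a : FormalFn 𝕜 l m) (lieFn e v) = 0 := by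
  have h : (ham e (X a : FormalFn 𝕜 l m)).toLinearMap ∘ₗ lieFn e = 0 := by
    refine e.ext fun i => ?_
    simp only [LinearMap.comp_apply, lieFn_basis]
    rcases a with j | j | j
    · exact ham_x_z e j i
    · exact ham_y_z e j i
    · simp at ha
  exact LinearMap.congr_fun h v

variable [CharZero 𝕜]

theorem ham_X_ham_X_X {a b c : Coord l m} (ha : wt a = 1) :
    ham e (X a : FormalFn 𝕜 l m) (ham e (X b) (X c)) = 0 := by
  by_cases hb : wt b = 1
  · obtain ⟨k, hk⟩ := ham_X_X_eq_C (b := c) e hb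
    rw [hk, ham_apply_C]
  by_cases hc : wt c = 1
  · obtain ⟨k, hk⟩ := ham_X_X_eq_C (b := b) e hc
    rw [ham_skew e (X c), hk, map_neg, ham_apply_C, neg_zero]
  rcases b with i | i | i
  · simp at hb
  · simp at hb
  rcases c with j | j | j
  · simp at hc
  · simp at hc
  rw [← lieFn_basis e, ← lieFn_basis e, ham_lieFn, ham_X_lieFn e ha]

theorem jacobiator_X_of_wt {a b c : Coord l m} (ha : wt a = 1) :
    jacobiator e (X a : FormalFn 𝕜 l m) (X b) (X c) = 0 := by
  obtain ⟨k, hk⟩ := ham_X_X_eq_C (b := b) e ha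
  obtain ⟨k', hk'⟩ := ham_X_X_eq_C (b := c) e ha
  rw [jacobiator_apply, ham_X_ham_X_X e ha, hk, hk', ham_C, ham_apply_C]
  simp

theorem jacobiator_X (a b c : Coord l m) :
    jacobiator e (X a : FormalFn 𝕜 l m) (X b) (X c) = 0 := by
  by_cases ha : wt a = 1
  · exact jacobiator_X_of_wt e ha
  by_cases hb : wt b = 1
  · rw [jacobiator_cyclic]; exact jacobiator_X_of_wt e hb
  by_cases hc : wt c = 1
  · rw [jacobiator_cyclic, jacobiator_cyclic]; exact jacobiator_X_of_wt e hc
  rcases a with i | i | i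
  · simp at ha
  · simp at ha
  rcases b with j | j | j
  · simp at hb
  · simp at hb
  rcases c with k | k | k
  · simp at hc
  · simp at hc
  rw [jacobiator_apply, ← lieFn_basis e, ← lieFn_basis e, ← lieFn_basis e]
  simp only [ham_lieFn]
  rw [← map_sub, ← map_sub, leibniz_lie]
  simp

theorem jacobiator_zero (f g : FormalFn 𝕜 l m) : jacobiator e f g = 0 := by
  have h1 : ∀ a b, jacobiator e (X a : FormalFn 𝕜 l m) (X b) = 0 :=
    fun a b => jacobiator_eq_zero e (jacobiator_X e a b)
  have h2 : ∀ a f, jacobiator e (X a : FormalFn 𝕜 l m) f = 0 := fun a f =>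
    jacobiator_eq_zero e fun b => by
      rw [jacobiator_cyclic, jacobiator_cyclic, h1, Derivation.zero_apply]
  refine jacobiator_eq_zero e fun a => ?_
  rw [jacobiator_cyclic, jacobiator_cyclic, h2, Derivation.zero_apply]

/-- The Jacobi identity. -/
theorem ham_ham (f g h : FormalFn 𝕜 l m) :
    ham e f (ham e g h) = ham e (ham e f g) h + ham e g (ham e f h) := by
  have h1 := jacobiator_apply e f g h
  rw [jacobiator_zero, Derivation.zero_apply] at h1
  rw [← sub_eq_zero, h1]
  abel

end Bracket

/-! ### Functoriality of the Jordan–Chevalley decomposition. -/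

section JordanChevalley

variable {K U W : Type*} [Field K] [AddCommGroup U] [Module K U]
  [FiniteDimensional K U] [AddCommGroup W] [Module K W]

open Polynomial in
theorem isSemisimple_map_algHom (φ : Module.End K U →ₐ[K] Module.End K W) {S : Module.End K U}
    (hS : S.IsSemisimple) : (φ S).IsSemisimple :=
  Module.End.isSemisimple_of_squarefree_aeval_eq_zero hS.minpoly_squarefree (by
    rw [aeval_algHom_apply, minpoly.aeval, map_zero])

variable [FiniteDimensional K W]

theorem isSemisimple_prodMap {S : Module.End K U} {T : Module.End K W}
    (hS : S.IsSemisimple) (hT : T.IsSemisimple) :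
    Module.End.IsSemisimple (LinearMap.prodMap S T : Module.End K (U × W)) := by
  classical
  have h0 : minpoly K S * minpoly K T ≠ 0 :=
    mul_ne_zero (minpoly.ne_zero_of_finite K S) (minpoly.ne_zero_of_finite K T)
  refine Module.End.isSemisimple_of_squarefree_aeval_eq_zero
    (p := UniqueFactorizationMonoid.radical (minpoly K S * minpoly K T))
    UniqueFactorizationMonoid.squarefree_radical (LinearMap.ext fun x => ?_)
  have hx : x = LinearMap.inl K U W x.1 + LinearMap.inr K U W x.2 := by simp
  rw [hx, map_add, ← aeval_intertwine (LinearMap.inl K U W) (S := S) (by simp),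
    ← aeval_intertwine (LinearMap.inr K U W) (S := T) (by simp),
    LocSemisimple.of_dvd (p := minpoly K S) _ (by rw [minpoly.aeval, LinearMap.zero_apply]),
    LocSemisimple.of_dvd (p := minpoly K T) _ (by rw [minpoly.aeval, LinearMap.zero_apply]),
    map_zero, map_zero, add_zero, LinearMap.zero_apply]
  · exact (UniqueFactorizationMonoid.dvd_radical_iff hT.minpoly_squarefree.isRadical h0).2
      (dvd_mul_left _ _)
  · exact (UniqueFactorizationMonoid.dvd_radical_iff hS.minpoly_squarefree.isRadical h0).2
      (dvd_mul_right _ _)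

omit [FiniteDimensional K U] [FiniteDimensional K W] in
theorem isNilpotent_prodMap {S : Module.End K U} {T : Module.End K W}
    (hS : IsNilpotent S) (hT : IsNilpotent T) :
    IsNilpotent (LinearMap.prodMap S T : Module.End K (U × W)) := by
  obtain ⟨k, hk⟩ := hS
  obtain ⟨j, hj⟩ := hT
  have h : IsNilpotent ((S, T) : Module.End K U × Module.End K W) :=
    ⟨k + j, by rw [Prod.pow_mk, pow_add, hk, zero_mul, pow_add, hj, mul_zero]; rfl⟩
  exact h.map (LinearMap.prodMapRingHom K U W)

/-- A linear map intertwining two operators intertwines their semisimple parts. -/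
theorem intertwine_semisimple_part [PerfectField K] {S N : Module.End K U} {S' N' : Module.End K W}
    (hS : S.IsSemisimple) (hN : IsNilpotent N) (hc : Commute N S) (hS' : S'.IsSemisimple)
    (hN' : IsNilpotent N') (hc' : Commute N' S') (B : U →ₗ[K] W)
    (h : ∀ u, B ((N + S) u) = (N' + S') (B u)) (u : U) : B (S u) = S' (B u) := by
  set T : Module.End K (U × W) := LinearMap.prodMap N N' + LinearMap.prodMap S S' with hT
  obtain ⟨n, hn, s, hs, hn_nil, hs_ss, hns⟩ := T.exists_isNilpotent_isSemisimple
  have hcns : Commute n s := Algebra.commute_of_mem_adjoin_singleton_of_commute hs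
    (Algebra.commute_of_mem_adjoin_singleton_of_commute hn (Commute.refl T)).symm
  have hcp : Commute (LinearMap.prodMap N N' : Module.End K (U × W)) (LinearMap.prodMap S S') := by
    change _ * _ = _ * _
    rw [LinearMap.prodMap_mul, LinearMap.prodMap_mul, hc.eq, hc'.eq]
  have huniq := (Module.End.isNilpotent_isSemisimple_unique hn_nil hs_ss
    (isNilpotent_prodMap hN hN') (isSemisimple_prodMap hS hS') hcns hcp hns.symm).2
  -- Viewed as an endomorphism of `U × W`, `B` commutes with `T`, hence with the semisimple part
  -- `s`, a polynomial in `T`; by uniqueness `s` is `S × S'`.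
  let b : Module.End K (U × W) := LinearMap.inr K U W ∘ₗ B ∘ₗ LinearMap.fst K U W
  have hb : Commute b T := by
    refine LinearMap.ext fun x => ?_
    have := h x.1
    simp only [Module.End.mul_apply, b, hT, LinearMap.comp_apply, LinearMap.add_apply] at this ⊢
    simp [this]
  have hbs : Commute b s := Algebra.commute_of_mem_adjoin_singleton_of_commute hs hb
  rw [huniq] at hbs
  have := congrArg Prod.snd (LinearMap.congr_fun hbs.eq (u, 0))
  simpa [b] using this

end JordanChevalley

/-! ### Semisimple parts of inner derivations. -/

section Adjoint

variable {K 𝔤 : Type*} [Field K] [CharZero K] [LieRing 𝔤] [LieAlgebra K 𝔤]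
  [FiniteDimensional K 𝔤]

open TensorProduct in
/-- The semisimple part of a derivation of a Lie algebra is a derivation. -/
theorem semisimple_part_leibniz {S N : Module.End K 𝔤} (hS : S.IsSemisimple) (hN : IsNilpotent N)
    (hc : Commute N S) (h : ∀ u v : 𝔤, (N + S) ⁅u, v⁆ = ⁅(N + S) u, v⁆ + ⁅u, (N + S) v⁆) (u v : 𝔤) :
    S ⁅u, v⁆ = ⁅S u, v⁆ + ⁅u, S v⁆ := by
  let r := Module.End.rTensorAlgHom K 𝔤 𝔤
  let t := Module.End.lTensorAlgHom K 𝔤 𝔤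
  have hr : ∀ X a b, r X (a ⊗ₜ[K] b) = X a ⊗ₜ[K] b := fun _ _ _ => rfl
  have ht : ∀ X a b, t X (a ⊗ₜ[K] b) = a ⊗ₜ[K] X b := fun _ _ _ => rfl
  have hrt : ∀ X Y : Module.End K 𝔤, Commute (r X) (t Y) := fun X Y =>
    TensorProduct.ext' fun a b => by
      simp only [Module.End.mul_apply, hr, ht]
  -- A derivation `D` is one for which the bracket `𝔤 ⊗ 𝔤 → 𝔤` intertwines `D ⊗ 1 + 1 ⊗ D` with `D`.
  -- Their semisimple parts are `S ⊗ 1 + 1 ⊗ S` and `S`.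
  have h1 := intertwine_semisimple_part (K := K) (S := r S + t S) (N := r N + t N)
    ((isSemisimple_map_algHom r hS).add_of_commute (hrt S S) (isSemisimple_map_algHom t hS))
    ((hrt N N).isNilpotent_add (hN.map r) (hN.map t))
    (((hc.map r).add_right (hrt N S)).add_left (((hrt S N).symm).add_right (hc.map t)))
    hS hN hc (TensorProduct.lift (lieBilin K 𝔤)) (by
      intro x
      induction x using TensorProduct.induction_on with
      | zero => simp
      | add x y hx hy => rw [map_add, map_add, hx, hy, map_add, map_add]
      | tmul a b =>
        have := h a b
        simp only [LinearMap.add_apply, add_lie, lie_add] at this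
        simp only [LinearMap.add_apply, hr, ht, map_add, TensorProduct.lift.tmul, lieBilin_apply, this]
        abel) (u ⊗ₜ[K] v)
  simpa only [LinearMap.add_apply, hr, ht, map_add, TensorProduct.lift.tmul, lieBilin_apply]
    using h1.symm

/-- In a Lie algebra with nondegenerate Killing form, the semisimple part of an inner derivation is
inner. -/
theorem exists_ad_semisimple_part [LieAlgebra.IsKilling K 𝔤] (ξ : 𝔤) : ∃ τ : 𝔤,
    Module.End.IsSemisimple (lieBilin K 𝔤 τ) ∧
    IsNilpotent (lieBilin K 𝔤 ξ - lieBilin K 𝔤 τ) ∧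
    Commute (lieBilin K 𝔤 ξ - lieBilin K 𝔤 τ) (lieBilin K 𝔤 τ) := by
  obtain ⟨n, hn, s, hs, hn_nil, hs_ss, hns⟩ :=
    Module.End.exists_isNilpotent_isSemisimple (f := (lieBilin K 𝔤 ξ : Module.End K 𝔤))
  have hcns : Commute n s := Algebra.commute_of_mem_adjoin_singleton_of_commute hs
    (Algebra.commute_of_mem_adjoin_singleton_of_commute hn (Commute.refl _)).symm
  have hder := semisimple_part_leibniz hs_ss hn_nil hcns (by
    intro u v
    rw [← hns]
    simp only [lieBilin_apply]
    exact leibniz_lie ξ u v)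
  obtain ⟨τ, hτ⟩ := LieDerivation.IsKilling.exists_eq_ad (R := K) (L := 𝔤)
    { s with
      leibniz' := fun a b => by
        change s ⁅a, b⁆ = ⁅a, s b⁆ - ⁅b, s a⁆
        rw [hder, ← lie_skew b (s a)]
        abel }
  have hτs : lieBilin K 𝔤 τ = s := LinearMap.ext fun v => by
    rw [lieBilin_apply]
    simpa using DFunLike.congr_fun hτ v
  refine ⟨τ, ?_⟩
  rw [hτs, hns, add_sub_cancel_right]
  exact ⟨hs_ss, hn_nil, hcns⟩

end Adjoint

/-! ### Semisimple parts of matrices, also acting on row vectors. -/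

section MatrixParts

open Matrix

variable {K ι : Type*} [Field K] [Fintype ι] [DecidableEq ι]

open Polynomial in
theorem aeval_vecMulLinear (S : Matrix ι ι K) (p : K[X]) (v : ι → K) :
    aeval (S.vecMulLinear : Module.End K (ι → K)) p v = v ᵥ* aeval S p := by
  induction p using Polynomial.induction_on' generalizing v with
  | add p q hp hq => simp [hp, hq, vecMul_add]
  | monomial n a =>
    have : ∀ n (v : ι → K), ((S.vecMulLinear : Module.End K (ι → K)) ^ n) v = v ᵥ* S ^ n := by
      intro n
      induction n with
      | zero => simp
      | succ n ih => intro v; rw [pow_succ, pow_succ', Module.End.mul_apply, ih]; simp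
    simp [aeval_monomial, this, Algebra.algebraMap_eq_smul_one,
      vecMul_smul]

theorem vecMulLinear_pow_apply (S : Matrix ι ι K) (n : ℕ) (v : ι → K) :
    ((S.vecMulLinear : Module.End K (ι → K)) ^ n) v = v ᵥ* S ^ n := by
  simpa using aeval_vecMulLinear S (Polynomial.X ^ n) v

theorem minpoly_toLin'_aeval (S : Matrix ι ι K) :
    Polynomial.aeval S (minpoly K (Matrix.toLin' S)) = 0 := by
  rw [Matrix.minpoly_toLin', minpoly.aeval]

theorem isSemisimple_vecMulLinear {S : Matrix ι ι K}
    (hS : Module.End.IsSemisimple (Matrix.toLin' S)) :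
    Module.End.IsSemisimple (S.vecMulLinear : Module.End K (ι → K)) :=
  Module.End.isSemisimple_of_squarefree_aeval_eq_zero hS.minpoly_squarefree
    (LinearMap.ext fun v => by
      rw [aeval_vecMulLinear, minpoly_toLin'_aeval, vecMul_zero, LinearMap.zero_apply])

theorem isNilpotent_vecMulLinear {N : Matrix ι ι K} (hN : IsNilpotent N) :
    IsNilpotent (N.vecMulLinear : Module.End K (ι → K)) := by
  obtain ⟨k, hk⟩ := hN
  exact ⟨k, LinearMap.ext fun v => by
    rw [vecMulLinear_pow_apply, hk, vecMul_zero, LinearMap.zero_apply]⟩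

variable [PerfectField K]

theorem exists_isSemisimplePart (A : Matrix ι ι K) : ∃ S, IsSemisimplePart S A := by
  obtain ⟨n, hn, s, hs, hn_nil, hs_ss, hns⟩ :=
    Module.End.exists_isNilpotent_isSemisimple (f := Matrix.toLin' A)
  have hcns : Commute n s := Algebra.commute_of_mem_adjoin_singleton_of_commute hs
    (Algebra.commute_of_mem_adjoin_singleton_of_commute hn (Commute.refl _)).symm
  have hA : A = LinearMap.toMatrixAlgEquiv' n + LinearMap.toMatrixAlgEquiv' s := by
    rw [← map_add, ← hns]
    exact (LinearMap.toMatrix'_toLin' A).symm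
  refine ⟨LinearMap.toMatrixAlgEquiv' s, ?_, ?_, ?_⟩
  · have : Matrix.toLin' (LinearMap.toMatrixAlgEquiv' s) = s := Matrix.toLin'_toMatrix' s
    rwa [this]
  · rw [hA, add_sub_cancel_right]
    exact hn_nil.map (LinearMap.toMatrixAlgEquiv' (R := K) (n := ι))
  · rw [hA, add_sub_cancel_right]
    exact (hcns.map (LinearMap.toMatrixAlgEquiv' (R := K) (n := ι))).symm

/-- If `J A` is symmetric for an antisymmetric `J`, then so is `J S` for the semisimple part `S`
of `A`. -/
theorem mul_semisimplePart_transpose {S A J : Matrix ι ι K} (h : IsSemisimplePart S A)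
    (hJ : Jᵀ = -J) (hA : (J * A)ᵀ = J * A) : (J * S)ᵀ = J * S := by
  obtain ⟨hS, hN, hc⟩ := h
  -- Symmetry of `J A` reads `J A = -Aᵀ J`, so `J` intertwines `A` with `-Aᵀ`, whose semisimple part
  -- is `-Sᵀ`. Transposes appear as `vecMulLinear`.
  have h1 := intertwine_semisimple_part (K := K) (S := Matrix.toLin' S) (N := Matrix.toLin' (A - S))
    (S' := -(S.vecMulLinear : Module.End K (ι → K))) (N' := -((A - S).vecMulLinear : Module.End K _))
    hS (hN.map (Matrix.toLinAlgEquiv' (R := K) (n := ι)))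
    ((hc.map (Matrix.toLinAlgEquiv' (R := K) (n := ι))).symm)
    (Module.End.isSemisimple_neg.2 (isSemisimple_vecMulLinear hS))
    (isNilpotent_vecMulLinear hN).neg
    (by
      refine LinearMap.ext fun v => ?_
      simp only [Module.End.mul_apply, LinearMap.neg_apply, map_neg, neg_neg, vecMulLinear_apply,
        vecMul_vecMul, hc.eq])
    (Matrix.toLin' J) (by
      intro v
      rw [← map_add, sub_add_cancel]
      rw [transpose_mul, hJ] at hA
      simp only [Matrix.toLin'_apply, mulVec_mulVec, ← hA, LinearMap.add_apply, LinearMap.neg_apply,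
        vecMulLinear_apply, ← neg_add, ← vecMul_add, sub_add_cancel]
      rw [mul_neg, neg_mulVec, ← mulVec_mulVec, mulVec_transpose])
  rw [transpose_mul, hJ, mul_neg]
  refine Matrix.toLin'.injective (LinearMap.ext fun v => ?_)
  have := h1 v
  simp only [Matrix.toLin'_apply, mulVec_mulVec, LinearMap.neg_apply, vecMulLinear_apply] at this ⊢
  rw [this, neg_mulVec, ← mulVec_mulVec, mulVec_transpose]

end MatrixParts

/-! ### Matrices of linear Hamiltonian vector fields. -/

section HamiltonianMatrices

open Matrix

variable {l m : ℕ} {𝕜 : Type*} [Field 𝕜] {𝔤 : Type*} [LieRing 𝔤] [LieAlgebra 𝕜 𝔤]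
  (e : Module.Basis (Fin m) 𝕜 𝔤)

/-- The inclusion of `𝔤` into the space of linear functions. -/
noncomputable def lieIncl (l : ℕ) : 𝔤 →ₗ[𝕜] (Coord l m → 𝕜) where
  toFun v := Sum.elim (fun _ => 0) (Sum.elim (fun _ => 0) (e.repr v))
  map_add' v v' := by ext (a | a | a) <;> simp
  map_smul' c v := by ext (a | a | a) <;> simp

theorem linFn_lieIncl (v : 𝔤) : linFn (lieIncl e l v) = (lieFn e v : FormalFn 𝕜 l m) := by
  simp [linFn, lieFn, lieIncl]

theorem lieIncl_basis (i : Fin m) : lieIncl e l (e i) = Pi.single (Coord.z i) 1 := by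
  ext (a | a | a) <;> simp [lieIncl, Finsupp.single_apply, Pi.single_apply, eq_comm]

/-- The matrix of the Hamiltonian vector field of `½ ∑ Q_ab uₐ u_b + ξ`. -/
noncomputable def hamMatrix (Q : Matrix (Coord l m) (Coord l m) 𝕜) (ξ : 𝔤) :
    Matrix (Coord l m) (Coord l m) 𝕜 :=
  Matrix.of (Sum.elim (fun i => -Q (Coord.y i)) (Sum.elim (fun i => Q (Coord.x i))
    fun i => lieIncl e l ⁅ξ, e i⁆))

/-- The matrix of the constant part of the Poisson structure. -/
def sympMatrix (l m : ℕ) (𝕜 : Type*) [Field 𝕜] : Matrix (Coord l m) (Coord l m) 𝕜 :=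
  Matrix.of (Sum.elim (fun i => Pi.single (Coord.y i) 1) (Sum.elim (fun i => -Pi.single (Coord.x i) 1)
    fun _ => 0))

theorem sympMatrix_mul (S : Matrix (Coord l m) (Coord l m) 𝕜) :
    sympMatrix l m 𝕜 * S = Matrix.of (Sum.elim (fun i => S (Coord.y i))
      (Sum.elim (fun i => -S (Coord.x i)) fun _ => 0)) := by
  ext (a | a | a) b <;> simp [sympMatrix, Matrix.mul_apply, Pi.single_apply]

theorem sympMatrix_transpose : (sympMatrix l m 𝕜)ᵀ = -sympMatrix l m 𝕜 := by
  ext (a | a | a) (b | b | b) <;> simp [sympMatrix, Pi.single_apply, eq_comm]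

/-- With `hamMatrix_sympMatrix_mul` this characterizes Hamiltonian matrices: the product with
`sympMatrix` must be symmetric and the `z` rows must come from some `ad τ`. -/
theorem sympMatrix_mul_hamMatrix {Q : Matrix (Coord l m) (Coord l m) 𝕜}
    (hQ : ∀ i, Q (Coord.z i) = 0) (ξ : 𝔤) : sympMatrix l m 𝕜 * hamMatrix e Q ξ = Q := by
  rw [sympMatrix_mul]
  ext (a | a | a) b
  · simp [hamMatrix]
  · simp [hamMatrix]
  · simp [hQ]

theorem hamMatrix_sympMatrix_mul {S : Matrix (Coord l m) (Coord l m) 𝕜} {τ : 𝔤}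
    (hS : ∀ i, S (Coord.z i) = lieIncl e l ⁅τ, e i⁆) :
    hamMatrix e (sympMatrix l m 𝕜 * S) τ = S := by
  rw [sympMatrix_mul]
  ext (a | a | a) b
  · simp [hamMatrix]
  · simp [hamMatrix]
  · simp [hamMatrix, hS]

/-- On linear functions, written as row vectors, `𝔤` is an invariant subspace on which the matrix
acts as `ad ξ`. -/
theorem lieIncl_vecMul_hamMatrix (Q : Matrix (Coord l m) (Coord l m) 𝕜) (ξ v : 𝔤) :
    lieIncl e l v ᵥ* hamMatrix e Q ξ = lieIncl e l ⁅ξ, v⁆ := by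
  have h : (hamMatrix e Q ξ).vecMulLinear ∘ₗ lieIncl e l = lieIncl e l ∘ₗ lieBilin 𝕜 𝔤 ξ := by
    refine e.ext fun i => ?_
    simp only [LinearMap.comp_apply, lieIncl_basis, vecMulLinear_apply, single_one_vecMul]
    rfl
  exact LinearMap.congr_fun h v

/-- The semisimple part of the matrix of a linear Hamiltonian vector field is of the same form. -/
theorem exists_hamMatrix_semisimplePart [CharZero 𝕜] [LieAlgebra.IsKilling 𝕜 𝔤]
    {Q : Matrix (Coord l m) (Coord l m) 𝕜} (hQ : Qᵀ = Q) (hQz : ∀ i, Q (Coord.z i) = 0) (ξ : 𝔤) :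
    ∃ (Q' : Matrix (Coord l m) (Coord l m) 𝕜) (τ : 𝔤), Q'ᵀ = Q' ∧ (∀ i, Q' (Coord.z i) = 0) ∧
      IsSemisimplePart (hamMatrix e Q' τ) (hamMatrix e Q ξ) := by
  have : FiniteDimensional 𝕜 𝔤 := Module.Finite.of_basis e
  obtain ⟨S, hS⟩ := exists_isSemisimplePart (hamMatrix e Q ξ)
  obtain ⟨τ, hτ, hτn, hτc⟩ := exists_ad_semisimple_part (K := 𝕜) ξ
  have hSz : ∀ i, S (Coord.z i) = lieIncl e l ⁅τ, e i⁆ := by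
    intro i
    -- As `lieIncl` intertwines `ad ξ` with the matrix, it intertwines their semisimple parts `ad τ`
    -- and `S`; this gives the `z` rows of `S`.
    have h1 := intertwine_semisimple_part (K := 𝕜) hτ hτn hτc (isSemisimple_vecMulLinear hS.1)
      (isNilpotent_vecMulLinear hS.2.1) (by
        refine LinearMap.ext fun v => ?_
        simp only [Module.End.mul_apply, vecMulLinear_apply, vecMul_vecMul, hS.2.2.eq])
      (lieIncl e l) (by
        intro u
        rw [sub_add_cancel, LinearMap.add_apply, vecMulLinear_apply, vecMulLinear_apply,
          ← vecMul_add, sub_add_cancel, lieIncl_vecMul_hamMatrix, lieBilin_apply]) (e i)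
    rw [lieBilin_apply, lieIncl_basis, vecMulLinear_apply, single_one_vecMul] at h1
    exact h1.symm
  refine ⟨sympMatrix l m 𝕜 * S, τ, ?_, ?_, ?_⟩
  · refine mul_semisimplePart_transpose hS sympMatrix_transpose ?_
    rw [sympMatrix_mul_hamMatrix e hQz, hQ]
  · intro i
    rw [sympMatrix_mul]
    rfl
  · rwa [hamMatrix_sympMatrix_mul e hSz]

theorem hamMatrix_eq_zero_of_wt_ne {Q : Matrix (Coord l m) (Coord l m) 𝕜} (hQ : Qᵀ = Q)
    (hQz : ∀ i, Q (Coord.z i) = 0) (ξ : 𝔤) {a b : Coord l m} (hab : wt a ≠ wt b) :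
    hamMatrix e Q ξ a b = 0 := by
  have hQz' : ∀ a i, Q a (Coord.z i) = 0 := fun a i => by
    rw [← hQ, transpose_apply, hQz, Pi.zero_apply]
  rcases a with a | a | a <;> rcases b with b | b | b <;>
    simp_all [hamMatrix, lieIncl]

end HamiltonianMatrices

/-! ### Linear vector fields and the homological equation. -/

section LinearFields

open Matrix

variable {l m : ℕ} {𝕜 : Type*} [Field 𝕜]

theorem linFn_apply (v : Coord l m → 𝕜) : linFn v = ∑ a, C (v a) * X a := rfl

theorem linearVF_apply (A : Matrix (Coord l m) (Coord l m) 𝕜) (a : Coord l m) :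
    linearVF A a = linFn (A a) := rfl

theorem linFn_single (a : Coord l m) : linFn (Pi.single a (1 : 𝕜)) = X a := by
  rw [linFn_apply, Finset.sum_eq_single a]
  · simp
  · intro b _ hb
    rw [Pi.single_eq_of_ne hb, map_zero, zero_mul]
  · simp

theorem pderiv_linFn (v : Coord l m → 𝕜) (b : Coord l m) :
    pderiv 𝕜 b (linFn v) = C (v b) := by
  rw [linFn_apply, map_sum, Finset.sum_eq_single b]
  · simp [pderiv_X_self]
  · intro a _ hab
    rw [Derivation.leibniz, pderiv_X_of_ne hab, pderiv_C]
    simp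
  · simp

theorem derivation_linFn (D : Derivation 𝕜 (FormalFn 𝕜 l m) (FormalFn 𝕜 l m))
    (v : Coord l m → 𝕜) : D (linFn v) = ∑ a, C (v a) * D (X a) := by
  rw [linFn_apply, map_sum]
  refine Finset.sum_congr rfl fun a _ => ?_
  rw [← smul_eq_C_mul, ← smul_eq_C_mul, D.map_smul]

/-- The derivation along a linear vector field. -/
noncomputable abbrev linDerivation (A : Matrix (Coord l m) (Coord l m) 𝕜) :
    Derivation 𝕜 (FormalFn 𝕜 l m) (FormalFn 𝕜 l m) := vfDerivation (linearVF A)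

theorem linDerivation_linFn (A : Matrix (Coord l m) (Coord l m) 𝕜) (v : Coord l m → 𝕜) :
    linDerivation A (linFn v) = linFn (v ᵥ* A) := by
  rw [derivation_linFn]
  simp only [vfDerivation_X, linearVF_apply]
  have : v ᵥ* A = ∑ a, v a • A a := by
    ext b; simp [vecMul, dotProduct]
  rw [this, map_sum]
  exact Finset.sum_congr rfl fun a _ => by rw [map_smul, smul_eq_C_mul]

theorem linDerivation_lowers (A : Matrix (Coord l m) (Coord l m) 𝕜) (n : ℕ) (f : FormalFn 𝕜 l m)
    (hf : f ∈ fil 𝕜 wt n) : linDerivation A f ∈ fil 𝕜 wt (n - 2) :=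
  vfDerivation_mem_fil_sub_two _ hf

theorem linDerivation_add (A B : Matrix (Coord l m) (Coord l m) 𝕜) :
    linDerivation (A + B) = linDerivation A + linDerivation B := by
  refine derivation_ext_of_fil one_le_wt 2 (linDerivation_lowers _)
    (fun n f hf => add_mem (linDerivation_lowers A n f hf) (linDerivation_lowers B n f hf))
    fun a => ?_
  rw [Derivation.add_apply, vfDerivation_X, vfDerivation_X, vfDerivation_X]
  exact map_add linFn (A a) (B a)

theorem linDerivation_commute {A B : Matrix (Coord l m) (Coord l m) 𝕜} (h : Commute A B) :
    Commute (linDerivation A : Module.End 𝕜 (FormalFn 𝕜 l m)) (linDerivation B) := by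
  have h1 : ⁅linDerivation A, linDerivation B⁆ = 0 := by
    refine derivation_ext_of_fil one_le_wt 4 (fun n f hf => ?_) (fun n f _ => zero_mem _)
      fun a => ?_
    · rw [Derivation.commutator_apply]
      exact sub_mem
        (fil_mono (by omega) (linDerivation_lowers A _ _ (linDerivation_lowers B _ _ hf)))
        (fil_mono (by omega) (linDerivation_lowers B _ _ (linDerivation_lowers A _ _ hf)))
    · rw [Derivation.commutator_apply, ← linFn_single]
      simp only [linDerivation_linFn, vecMul_vecMul, h.eq, sub_self, Derivation.zero_apply]
  refine LinearMap.ext fun f => ?_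
  have := DFunLike.congr_fun h1 f
  rw [Derivation.commutator_apply, Derivation.zero_apply, sub_eq_zero] at this
  exact this

/-- The matrix respects the weights of the coordinates. -/
def WeightPreserving (A : Matrix (Coord l m) (Coord l m) 𝕜) : Prop :=
  ∀ a b, wt a ≠ wt b → A a b = 0

/-- The matrix strictly raises the weights of the coordinates. -/
def WeightRaising (A : Matrix (Coord l m) (Coord l m) 𝕜) : Prop :=
  ∀ a b, wt b ≤ wt a → A a b = 0

theorem WeightPreserving.sub {A B : Matrix (Coord l m) (Coord l m) 𝕜} (hA : WeightPreserving A)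
    (hB : WeightPreserving B) : WeightPreserving (A - B) := fun a b h => by
  rw [Matrix.sub_apply, hA a b h, hB a b h, sub_zero]

theorem WeightPreserving.linDerivation_mem_fil {A : Matrix (Coord l m) (Coord l m) 𝕜}
    (hA : WeightPreserving A) {n : ℕ} {f : FormalFn 𝕜 l m} (hf : f ∈ fil 𝕜 wt n) :
    linDerivation A f ∈ fil 𝕜 wt n := by
  refine vfDerivation_mem_fil (k := 0) _ (fun a => ?_) hf
  rw [linearVF_apply, linFn_apply]
  refine sum_mem fun b _ => ?_
  by_cases hab : wt a = wt b
  · rw [add_zero, hab]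
    exact C_mul_mem_fil _ (X_mem_fil b)
  · rw [hA a b hab, map_zero, zero_mul]
    exact zero_mem _

/-- The only weights are 1 and 2, so weight cannot be raised twice. -/
theorem WeightRaising.mul_self {A : Matrix (Coord l m) (Coord l m) 𝕜} (hA : WeightRaising A) :
    A * A = 0 := by
  ext a b
  rw [Matrix.mul_apply]
  refine Finset.sum_eq_zero fun c _ => ?_
  rcases le_or_gt (wt c) (wt a) with h | h
  · rw [hA a c h, zero_mul]
  · rw [hA c b, mul_zero]
    have := one_le_wt a
    have := wt_le_two b
    omega

theorem WeightPreserving.pow {A : Matrix (Coord l m) (Coord l m) 𝕜}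
    (hA : WeightPreserving A) (k : ℕ) : WeightPreserving (A ^ k) := by
  induction k with
  | zero =>
    intro a b h
    rw [pow_zero, Matrix.one_apply_ne]
    rintro rfl
    exact h rfl
  | succ k ih =>
    intro a b h
    rw [pow_succ, Matrix.mul_apply]
    refine Finset.sum_eq_zero fun c _ => ?_
    by_cases hac : wt a = wt c
    · rw [hA c b (hac ▸ h), mul_zero]
    · rw [ih a c hac, zero_mul]

/-- Block triangularity: `(N + E) ^ k` and `N ^ k` differ by a weight-raising matrix, so once `N ^ k
= 0` the power `(N + E) ^ k` squares to zero. -/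
theorem WeightPreserving.isNilpotent_add {N E : Matrix (Coord l m) (Coord l m) 𝕜}
    (hN : WeightPreserving N) (hE : WeightRaising E) (h : IsNilpotent N) : IsNilpotent (N + E) := by
  have key : ∀ k, WeightRaising ((N + E) ^ k - N ^ k) := by
    intro k
    induction k with
    | zero => intro a b _; simp
    | succ k ih =>
      have h1 : (N + E) ^ (k + 1) - N ^ (k + 1)
          = ((N + E) ^ k - N ^ k) * N + ((N + E) ^ k - N ^ k) * E + N ^ k * E := by
        rw [pow_succ, pow_succ]; noncomm_ring
      intro a b hab
      rw [h1, Matrix.add_apply, Matrix.add_apply, Matrix.mul_apply, Matrix.mul_apply,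
        Matrix.mul_apply]
      rw [Finset.sum_eq_zero, Finset.sum_eq_zero, Finset.sum_eq_zero, add_zero, add_zero]
      · intro c _
        by_cases hac : wt a = wt c
        · rw [hE c b (hac ▸ hab), mul_zero]
        · rw [hN.pow k a c hac, zero_mul]
      · intro c _
        rcases le_or_gt (wt c) (wt a) with h | h
        · rw [ih a c h, zero_mul]
        · rw [hE c b (by omega), mul_zero]
      · intro c _
        rcases le_or_gt (wt c) (wt a) with h | h
        · rw [ih a c h, zero_mul]
        · rw [hN c b (by omega), mul_zero]
  obtain ⟨k, hk⟩ := h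
  refine ⟨k * 2, ?_⟩
  have := (key k).mul_self
  rwa [hk, sub_zero, ← pow_two, ← pow_mul] at this

theorem locSemisimple_polynomial [PerfectField 𝕜]
    {D : Derivation 𝕜 (FormalFn 𝕜 l m) (FormalFn 𝕜 l m)}
    (h : ∀ a, LocSemisimple (D : Module.End 𝕜 (FormalFn 𝕜 l m)) (X a))
    (p : MvPolynomial (Coord l m) 𝕜) :
    LocSemisimple (D : Module.End 𝕜 (FormalFn 𝕜 l m)) p := by
  induction p using MvPolynomial.induction_on with
  | C c => exact .of_eq_zero (by rw [MvPolynomial.coe_C]; exact D.map_algebraMap c)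
  | add p q hp hq => rw [MvPolynomial.coe_add]; exact hp.add hq
  | mul_X p a hp =>
    rw [MvPolynomial.coe_mul, MvPolynomial.coe_X]
    exact LocSemisimple.bilin (LinearMap.mul 𝕜 (FormalFn 𝕜 l m))
      (fun f g => by simp [mul_comm, add_comm]) hp (h a)

theorem locNilpotent_polynomial {D : Derivation 𝕜 (FormalFn 𝕜 l m) (FormalFn 𝕜 l m)}
    (h : ∀ a, LocNilpotent (D : Module.End 𝕜 (FormalFn 𝕜 l m)) (X a))
    (p : MvPolynomial (Coord l m) 𝕜) :
    LocNilpotent (D : Module.End 𝕜 (FormalFn 𝕜 l m)) p := by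
  induction p using MvPolynomial.induction_on with
  | C c => exact ⟨1, by rw [MvPolynomial.coe_C, pow_one]; exact D.map_algebraMap c⟩
  | add p q hp hq => rw [MvPolynomial.coe_add]; exact hp.add hq
  | mul_X p a hp =>
    rw [MvPolynomial.coe_mul, MvPolynomial.coe_X]
    exact LocNilpotent.bilin (LinearMap.mul 𝕜 (FormalFn 𝕜 l m))
      (fun f g => by simp [mul_comm, add_comm]) hp (h a)

theorem linDerivation_locSemisimple [PerfectField 𝕜] {S : Matrix (Coord l m) (Coord l m) 𝕜}
    (hS : Module.End.IsSemisimple (Matrix.toLin' S)) (p : MvPolynomial (Coord l m) 𝕜) :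
    LocSemisimple (linDerivation S : Module.End 𝕜 (FormalFn 𝕜 l m)) p := by
  refine locSemisimple_polynomial (fun a => ?_) p
  refine ⟨_, (isSemisimple_vecMulLinear hS).minpoly_squarefree, ?_⟩
  rw [← linFn_single, ← aeval_intertwine linFn (S := (S.vecMulLinear : Module.End 𝕜 _))
    (fun v => (linDerivation_linFn S v).symm), minpoly.aeval, LinearMap.zero_apply, map_zero]

theorem linDerivation_locNilpotent {N : Matrix (Coord l m) (Coord l m) 𝕜}
    (hN : IsNilpotent N) (p : MvPolynomial (Coord l m) 𝕜) :
    LocNilpotent (linDerivation N : Module.End 𝕜 (FormalFn 𝕜 l m)) p := by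
  refine locNilpotent_polynomial (fun a => ?_) p
  obtain ⟨k, hk⟩ := isNilpotent_vecMulLinear hN
  refine ⟨k, ?_⟩
  have := aeval_intertwine linFn (S := (N.vecMulLinear : Module.End 𝕜 _))
    (T := (linDerivation N : Module.End 𝕜 (FormalFn 𝕜 l m)))
    (fun v => (linDerivation_linFn N v).symm) (Polynomial.X ^ k) (Pi.single a 1)
  rwa [map_pow, map_pow, Polynomial.aeval_X, Polynomial.aeval_X, hk, LinearMap.zero_apply, map_zero,
    linFn_single, eq_comm] at this

theorem linDerivation_eq_add_sub (S A : Matrix (Coord l m) (Coord l m) 𝕜) :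
    (linDerivation A : Module.End 𝕜 (FormalFn 𝕜 l m))
      = (linDerivation S : Module.End 𝕜 (FormalFn 𝕜 l m)) + linDerivation (A - S) := by
  conv_lhs => rw [← add_sub_cancel S A, linDerivation_add]
  rfl

/-- The homological equation: modulo terms of higher weight, every series is the sum of a series
killed by the semisimple part and of one in the image of the linear vector field. -/
theorem exists_homological [PerfectField 𝕜] {S A : Matrix (Coord l m) (Coord l m) 𝕜}
    (h : IsSemisimplePart S A) (hS : WeightPreserving S) (hA : WeightPreserving A) {n : ℕ}
    {f : FormalFn 𝕜 l m} (hf : f ∈ fil 𝕜 wt n) :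
    ∃ r ∈ fil 𝕜 wt n, ∃ u ∈ fil 𝕜 wt n, linDerivation S r = 0 ∧
      f - (r + linDerivation A u) ∈ fil 𝕜 wt (n + 1) := by
  -- Local semisimplicity and nilpotency are available only on polynomials, so `f` is replaced by
  -- one modulo weight `n + 1`.
  obtain ⟨p, hp⟩ := exists_polynomial_sub_mem_fil one_le_wt f (n + 1)
  have hpn : (p : FormalFn 𝕜 l m) ∈ fil 𝕜 wt n := by
    have := sub_mem hf (fil_mono n.le_succ hp)
    rwa [sub_sub_cancel] at this
  obtain ⟨r, hr, u, hu, hSr, hpru⟩ := exists_ker_add_range (M := fil 𝕜 wt n)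
    (linDerivation_commute h.2.2)
    (fun v hv => hS.linDerivation_mem_fil hv) (fun v hv => (hA.sub hS).linDerivation_mem_fil hv)
    hpn (linDerivation_locSemisimple h.1 p) (linDerivation_locNilpotent h.2.1 p)
  refine ⟨r, hr, u, hu, hSr, ?_⟩
  rw [← linDerivation_eq_add_sub] at hpru
  rw [hpru] at hp
  exact hp

/-- Applied to `h₂`: from `{h₂, h₂} = 0` it yields `{s, h₂} = 0`. -/
theorem linDerivation_eq_zero_of_semisimplePart [PerfectField 𝕜]
    {S A : Matrix (Coord l m) (Coord l m) 𝕜} (h : IsSemisimplePart S A)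
    (p : MvPolynomial (Coord l m) 𝕜) (hp : linDerivation A (p : FormalFn 𝕜 l m) = 0) :
    linDerivation S (p : FormalFn 𝕜 l m) = 0 := by
  refine apply_eq_zero_of_add_apply_eq_zero (linDerivation_commute h.2.2)
    (linDerivation_locSemisimple h.1 p) (linDerivation_locNilpotent h.2.1 p) ?_
  rw [← linDerivation_eq_add_sub]
  exact hp

end LinearFields

/-! ### Quadratic Hamiltonians and the leading part of `H`. -/

section QuadraticHamiltonians

open Matrix

variable {l m : ℕ} {𝕜 : Type*} [Field 𝕜] {𝔤 : Type*} [LieRing 𝔤] [LieAlgebra 𝕜 𝔤]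
  (e : Module.Basis (Fin m) 𝕜 𝔤)

/-- The Hamiltonian `½ ∑ Q_ab uₐ u_b + τ`, where `τ ∈ 𝔤` is a linear function of the `zⱼ`. -/
noncomputable def quadHam (Q : Matrix (Coord l m) (Coord l m) 𝕜) (τ : 𝔤) :
    MvPolynomial (Coord l m) 𝕜 :=
  MvPolynomial.C (1 / 2) * (∑ a, ∑ b, MvPolynomial.C (Q a b) * MvPolynomial.X b * MvPolynomial.X a)
    + ∑ k, MvPolynomial.C (e.repr τ k) * MvPolynomial.X (Coord.z k)

theorem quadHam_totalDegree_le (Q : Matrix (Coord l m) (Coord l m) 𝕜) (τ : 𝔤) :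
    (quadHam e Q τ).totalDegree ≤ 2 := by
  refine (MvPolynomial.totalDegree_add _ _).trans (max_le ?_ ?_)
  · refine (MvPolynomial.totalDegree_mul _ _).trans ?_
    rw [MvPolynomial.totalDegree_C, zero_add]
    refine MvPolynomial.totalDegree_finsetSum_le fun a _ =>
      MvPolynomial.totalDegree_finsetSum_le fun b _ => ?_
    refine (MvPolynomial.totalDegree_mul _ _).trans ?_
    have := (MvPolynomial.totalDegree_mul (MvPolynomial.C (Q a b))
      (MvPolynomial.X b : MvPolynomial (Coord l m) 𝕜))
    simp only [MvPolynomial.totalDegree_C, MvPolynomial.totalDegree_X] at this ⊢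
    omega
  · refine MvPolynomial.totalDegree_finsetSum_le fun k _ => ?_
    refine (MvPolynomial.totalDegree_mul _ _).trans ?_
    simp only [MvPolynomial.totalDegree_C, MvPolynomial.totalDegree_X]
    omega

theorem quadHam_constantCoeff (Q : Matrix (Coord l m) (Coord l m) 𝕜) (τ : 𝔤) :
    MvPolynomial.constantCoeff (quadHam e Q τ) = 0 := by
  simp [quadHam, map_sum]

theorem coe_quadHam (Q : Matrix (Coord l m) (Coord l m) 𝕜) (τ : 𝔤) :
    ((quadHam e Q τ : MvPolynomial (Coord l m) 𝕜) : FormalFn 𝕜 l m)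
      = C (1 / 2) * (∑ a, linFn (Q a) * X a) + lieFn e τ := by
  have hsum : ∀ {ι : Type} (s : Finset ι) (p : ι → MvPolynomial (Coord l m) 𝕜),
      ((∑ i ∈ s, p i : MvPolynomial (Coord l m) 𝕜) : FormalFn 𝕜 l m) = ∑ i ∈ s, (p i : FormalFn 𝕜 l m) :=
    fun s p => map_sum MvPolynomial.coeToMvPowerSeries.ringHom p s
  rw [quadHam, MvPolynomial.coe_add, MvPolynomial.coe_mul, MvPolynomial.coe_C, hsum, hsum]
  congr 1
  · congr 1
    refine Finset.sum_congr rfl fun a _ => ?_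
    rw [hsum, linFn_apply, Finset.sum_mul]
    refine Finset.sum_congr rfl fun b _ => ?_
    rw [MvPolynomial.coe_mul, MvPolynomial.coe_mul, MvPolynomial.coe_C, MvPolynomial.coe_X,
      MvPolynomial.coe_X]
  · refine Finset.sum_congr rfl fun k _ => ?_
    rw [MvPolynomial.coe_mul, MvPolynomial.coe_C, MvPolynomial.coe_X]

theorem linFn_eq_zero_coeff (v : Coord l m → 𝕜) : constantCoeff (linFn v) = 0 := by
  simp [linFn_apply, map_sum]

theorem lieFn_mem_fil (τ : 𝔤) : (lieFn e τ : FormalFn 𝕜 l m) ∈ fil 𝕜 wt 2 := by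
  change ∑ k, C (e.repr τ k) * X (Coord.z k) ∈ _
  exact sum_mem fun k _ => C_mul_mem_fil _ (X_mem_fil (w := wt) (Coord.z k))

theorem linFn_mem_fil (v : Coord l m → 𝕜) : linFn v ∈ fil 𝕜 wt 1 := by
  rw [linFn_apply]
  exact sum_mem fun b _ => C_mul_mem_fil _ (fil_mono (one_le_wt b) (X_mem_fil b))

theorem quadHam_mem_fil (Q : Matrix (Coord l m) (Coord l m) 𝕜) (τ : 𝔤) :
    (quadHam e Q τ : FormalFn 𝕜 l m) ∈ fil 𝕜 wt 2 := by
  rw [coe_quadHam]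
  exact add_mem (C_mul_mem_fil _ (sum_mem fun a _ => mul_mem_fil (linFn_mem_fil _)
    (fil_mono (one_le_wt a) (X_mem_fil a)))) (lieFn_mem_fil e τ)

variable [CharZero 𝕜]

theorem pderiv_quadHam {Q : Matrix (Coord l m) (Coord l m) 𝕜} (hQ : Qᵀ = Q) (τ : 𝔤)
    (c : Coord l m) : pderiv 𝕜 c (quadHam e Q τ : FormalFn 𝕜 l m)
      = linFn (Q c) + C (lieIncl e l τ c) := by
  rw [coe_quadHam, ← linFn_lieIncl, map_add, pderiv_linFn, ← smul_eq_C_mul, Derivation.map_smul,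
    map_sum]
  congr 1
  have h : ∀ a, pderiv 𝕜 c (linFn (Q a) * X a)
      = (if a = c then linFn (Q c) else 0) + C (Q c a) * X a := by
    intro a
    have hQa : Q a c = Q c a := by rw [← hQ, transpose_apply, hQ]
    rw [Derivation.leibniz, pderiv_linFn, hQa, smul_eq_mul, smul_eq_mul, mul_comm (X a)]
    split_ifs with hac
    · subst hac
      rw [pderiv_X_self, mul_one]
    · rw [pderiv_X_of_ne hac, mul_zero]
  rw [Finset.sum_congr rfl fun a _ => h a, Finset.sum_add_distrib, ← linFn_apply]
  rw [Finset.sum_ite_eq' Finset.univ c, if_pos (Finset.mem_univ c), ← two_smul 𝕜, smul_smul]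
  norm_num

theorem hamVF_quadHam {Q : Matrix (Coord l m) (Coord l m) 𝕜} (hQ : Qᵀ = Q)
    (hQz : ∀ i, Q (Coord.z i) = 0) (τ : 𝔤) :
    hamVF e (quadHam e Q τ : FormalFn 𝕜 l m) = linearVF (hamMatrix e Q τ) := by
  funext a
  rw [linearVF_apply, hamVF, ← ham_apply, ham_skew]
  rcases a with i | i | i
  · rw [ham_x, pderiv_quadHam e hQ]
    have h : lieIncl e l τ (Coord.y i) = 0 := rfl
    rw [h, map_zero, add_zero, ← map_neg]
    rfl
  · rw [ham_y, pderiv_quadHam e hQ]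
    have h : lieIncl e l τ (Coord.x i) = 0 := rfl
    rw [h, map_zero, add_zero, neg_neg]
    rfl
  · change _ = linFn (lieIncl e l ⁅τ, e i⁆)
    rw [linFn_lieIncl, ← ham_lieFn, lieFn_basis, ham_skew e (X (Coord.z i)) (lieFn e τ), ham_z,
      ham_z]
    congr 1
    refine Finset.sum_congr rfl fun j _ => ?_
    rw [pderiv_quadHam e hQ, hQz, map_zero, zero_add, ← linFn_lieIncl, pderiv_linFn]

theorem ham_quadHam {Q : Matrix (Coord l m) (Coord l m) 𝕜} (hQ : Qᵀ = Q)
    (hQz : ∀ i, Q (Coord.z i) = 0) (τ : 𝔤) :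
    ham e (quadHam e Q τ : FormalFn 𝕜 l m) = linDerivation (hamMatrix e Q τ) := by
  rw [ham_eq_vfDerivation, hamVF_quadHam e hQ hQz]

omit [CharZero 𝕜] in
theorem mem_fil_one {f : FormalFn 𝕜 l m} (hf : constantCoeff f = 0) : f ∈ fil 𝕜 wt 1 := by
  intro d hd
  have h1 := degree_le_weight (w := wt) one_le_wt d
  have h2 : d = 0 := by
    rw [← Finsupp.degree_eq_zero_iff]
    omega
  rw [h2]
  simpa using hf

omit [CharZero 𝕜] in
theorem constantCoeff_pderiv (f : FormalFn 𝕜 l m) (a : Coord l m) :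
    constantCoeff (pderiv 𝕜 a f) = coeff (Finsupp.single a 1) f := by
  rw [← coeff_zero_eq_constantCoeff_apply, coeff_pderiv]
  simp

omit [CharZero 𝕜] in
theorem pderiv_comm (f : FormalFn 𝕜 l m) (a b : Coord l m) :
    pderiv 𝕜 a (pderiv 𝕜 b f) = pderiv 𝕜 b (pderiv 𝕜 a f) := by
  have h : ⁅pderiv 𝕜 a, pderiv 𝕜 b⁆ = (0 : Derivation 𝕜 (FormalFn 𝕜 l m) (FormalFn 𝕜 l m)) := by
    have hmem : ∀ (c : Coord l m) n (g : FormalFn 𝕜 l m), g ∈ fil 𝕜 wt n →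
        pderiv 𝕜 c g ∈ fil 𝕜 wt (n - 2) := fun c n g hg =>
      fil_mono (by have := wt_le_two c; omega) (pderiv_mem_fil c hg)
    refine derivation_ext_of_fil one_le_wt 4 (fun n g hg => ?_) (fun n g _ => zero_mem _)
      fun c => ?_
    · rw [Derivation.commutator_apply]
      exact sub_mem (fil_mono (by omega) (hmem _ _ _ (hmem _ _ _ hg)))
        (fil_mono (by omega) (hmem _ _ _ (hmem _ _ _ hg)))
    · have hc : ∀ d : Coord l m, ∃ k : 𝕜, pderiv 𝕜 d (X c : FormalFn 𝕜 l m) = C k := fun d =>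
        ⟨_, by rw [← linFn_single, pderiv_linFn]⟩
      obtain ⟨k, hk⟩ := hc a
      obtain ⟨k', hk'⟩ := hc b
      rw [Derivation.commutator_apply, hk, hk', pderiv_C, pderiv_C, sub_zero,
        Derivation.zero_apply]
  have := DFunLike.congr_fun h f
  rwa [Derivation.commutator_apply, Derivation.zero_apply, sub_eq_zero] at this

/-- A Hamiltonian whose vector field vanishes at the origin agrees up to a constant and terms of
weight at least three with a quadratic one. -/
theorem exists_quadHam_leading_part (H : FormalFn 𝕜 l m)
    (hH : ∀ a, constantCoeff (hamVF e H a) = 0) :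
    ∃ (Q : Matrix (Coord l m) (Coord l m) 𝕜) (ξ : 𝔤), Qᵀ = Q ∧ (∀ i, Q (Coord.z i) = 0) ∧
      H - C (constantCoeff H) - (quadHam e Q ξ : FormalFn 𝕜 l m) ∈ fil 𝕜 wt 3 := by
  -- The `yᵢ` component of `X_H` is `∂H/∂xᵢ`, and the `xᵢ` component is `-∂H/∂yᵢ`; the first
  -- derivatives in `z` are unrestricted and make up `ξ`.
  have hx : ∀ i, constantCoeff (pderiv 𝕜 (Coord.x i) H) = 0 := by
    intro i
    have := hH (Coord.y i)
    rwa [hamVF, ← ham_apply, ham_skew, ham_y, neg_neg] at this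
  have hy : ∀ i, constantCoeff (pderiv 𝕜 (Coord.y i) H) = 0 := by
    intro i
    have := hH (Coord.x i)
    rwa [hamVF, ← ham_apply, ham_skew, ham_x, map_neg, neg_eq_zero] at this
  have hxy : ∀ a : Coord l m, wt a = 1 → constantCoeff (pderiv 𝕜 a H) = 0 := by
    rintro (i | i | i) hi
    · exact hx i
    · exact hy i
    · simp at hi
  let Q : Matrix (Coord l m) (Coord l m) 𝕜 := Matrix.of fun a b =>
    if wt a = 1 ∧ wt b = 1 then constantCoeff (pderiv 𝕜 a (pderiv 𝕜 b H)) else 0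
  have hQ : Qᵀ = Q := by
    ext a b
    simp only [Q, transpose_apply, of_apply, and_comm, pderiv_comm H a b]
  have hQz : ∀ i, Q (Coord.z i) = 0 := by
    intro i
    ext b
    simp [Q]
  let ξ : 𝔤 := ∑ k, constantCoeff (pderiv 𝕜 (Coord.z k) H) • e k
  have hξ : ∀ k, lieIncl e l ξ (Coord.z k) = constantCoeff (pderiv 𝕜 (Coord.z k) H) := by
    intro k
    simp [lieIncl, ξ, Finsupp.single_apply]
  have hξ' : ∀ a : Coord l m, wt a = 1 → lieIncl e l ξ a = 0 := by
    rintro (i | i | i) hi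
    · rfl
    · rfl
    · simp at hi
  refine ⟨Q, ξ, hQ, hQz, mem_fil_of_pderiv ?_ fun a => ?_⟩
  · rw [map_sub, map_sub, constantCoeff_C, sub_self, zero_sub, neg_eq_zero]
    rw [coe_quadHam, ← linFn_lieIncl]
    simp [linFn_eq_zero_coeff, map_sum]
  · rw [map_sub, map_sub, pderiv_C, sub_zero, pderiv_quadHam e hQ]
    by_cases ha : wt a = 1
    · rw [ha, hξ' a ha, map_zero, add_zero]
      refine mem_fil_of_pderiv ?_ fun b => ?_
      · rw [map_sub, hxy a ha, linFn_eq_zero_coeff, sub_zero]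
      · by_cases hb : wt b = 1
        · rw [hb, map_sub, pderiv_linFn]
          refine mem_fil_one ?_
          rw [map_sub, constantCoeff_C]
          simp only [Q, of_apply, ha, hb, and_self, if_true]
          rw [pderiv_comm, sub_self]
        · have h1 := one_le_wt b
          have : 3 - 1 - wt b = 0 := by omega
          rw [this]
          exact mem_fil_zero
    · rcases a with i | i | i
      · simp at ha
      · simp at ha
      · rw [hQz, map_zero, zero_add, hξ]
        refine mem_fil_one ?_
        rw [map_sub, constantCoeff_C, sub_self]

end QuadraticHamiltonians

/-! ### Limits in the weight filtration. -/

section Convergence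

variable {σ K : Type*} [Field K] {w : σ → ℕ}

/-- A sequence of series whose consecutive differences have increasing weight converges. -/
theorem exists_limit_of_fil (g : ℕ → MvPowerSeries σ K) (c : ℕ)
    (hg : ∀ n, g (n + 1) - g n ∈ fil K w (n + c)) (hc : 1 ≤ c) :
    ∃ G : MvPowerSeries σ K, ∀ n, G - g n ∈ fil K w (n + c) := by
  have hle : ∀ n j, g (n + j) - g n ∈ fil K w (n + c) := by
    intro n j
    induction j with
    | zero => simp
    | succ j ih =>
      have := add_mem (fil_mono (by omega) (hg (n + j))) ih
      rwa [sub_add_sub_cancel] at this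
  -- As `c ≥ 1`, the coefficient at `d` no longer changes from the index equal to the weight of `d`
  -- onwards.
  let G : MvPowerSeries σ K := fun d => coeff d (g (Finsupp.weight w d))
  have hG : ∀ d, coeff d G = coeff d (g (Finsupp.weight w d)) := fun _ => rfl
  refine ⟨G, fun n d hd => ?_⟩
  rw [map_sub, hG]
  rcases le_total n (Finsupp.weight w d) with h | h
  · obtain ⟨j, hj⟩ := Nat.exists_eq_add_of_le h
    rw [← map_sub, hj]
    exact hle n j d hd
  · obtain ⟨j, hj⟩ := Nat.exists_eq_add_of_le h
    have := hle (Finsupp.weight w d) j d (by omega)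
    rw [← hj, map_sub, sub_eq_zero] at this
    rw [this, sub_self]

end Convergence

/-! ### Birkhoff normalization. -/

section Normalization

variable {l m : ℕ} {𝕜 : Type*} [Field 𝕜] {𝔤 : Type*} [LieRing 𝔤] [LieAlgebra 𝕜 𝔤]
  (e : Module.Basis (Fin m) 𝕜 𝔤)

/-- The operator `{G, ·}`. -/
noncomputable abbrev hamEnd (G : FormalFn 𝕜 l m) : Module.End 𝕜 (FormalFn 𝕜 l m) :=
  (ham e G : FormalFn 𝕜 l m →ₗ[𝕜] FormalFn 𝕜 l m)

theorem raises_ham {G : FormalFn 𝕜 l m} (hG : G ∈ fil 𝕜 wt 3) : Raises wt (hamEnd e G) :=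
  fun _ _ hf => fil_mono (by omega) (ham_mem_fil e hG hf)

/-- The first iterates differ by `{G' - G, F}`, of weight at least `M` because `F` has weight 2;
each further bracket, with weight at least 3, gains one. So only the linear term of the exponential
varies below weight `M + 1`. -/
theorem pow_hamEnd_sub_mem {G G' F : FormalFn 𝕜 l m} (hG : G ∈ fil 𝕜 wt 3)
    (hG' : G' ∈ fil 𝕜 wt 3) {M : ℕ} (hGG' : G' - G ∈ fil 𝕜 wt M) (hF : F ∈ fil 𝕜 wt 2) (k : ℕ) :
    (hamEnd e G' ^ (k + 2)) F - (hamEnd e G ^ (k + 2)) F ∈ fil 𝕜 wt (M + 1) := by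
  have hstep : ∀ j, (hamEnd e G' ^ (j + 1)) F - (hamEnd e G ^ (j + 1)) F
      = ham e G' ((hamEnd e G' ^ j) F - (hamEnd e G ^ j) F)
        + ham e (G' - G) ((hamEnd e G ^ j) F) := by
    intro j
    rw [pow_succ', pow_succ', Module.End.mul_apply, Module.End.mul_apply, ham_sub,
      Derivation.sub_apply, map_sub]
    simp only [hamEnd, Derivation.coeFn_coe]
    abel
  have hlow : ∀ j, ham e (G' - G) ((hamEnd e G ^ (j + 1)) F) ∈ fil 𝕜 wt (M + 1) := fun j =>
    fil_mono (by omega) (ham_mem_fil e hGG' ((raises_ham e hG).pow_mem hF (j + 1)))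
  induction k with
  | zero =>
    rw [hstep]
    refine add_mem (raises_ham e hG' _ _ ?_) (hlow 0)
    have h1 := hstep 0
    simp only [pow_zero, sub_self, map_zero, Module.End.one_apply, zero_add] at h1 ⊢
    rw [h1]
    exact fil_mono (show M ≤ M + 2 - 2 by omega) (ham_mem_fil e hGG' hF)
  | succ k ih =>
    rw [hstep]
    exact add_mem (fil_mono (by omega) (raises_ham e hG' _ _ ih)) (hlow (k + 1))

/-- The first order variation of the exponential. -/
theorem expSeries_ham_sub_mem {G G' F : FormalFn 𝕜 l m} (hG : G ∈ fil 𝕜 wt 3)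
    (hG' : G' ∈ fil 𝕜 wt 3) {M : ℕ} (hGG' : G' - G ∈ fil 𝕜 wt M)
    (hF : F ∈ fil 𝕜 wt 2) :
    expSeries wt (hamEnd e G') F - expSeries wt (hamEnd e G) F - ham e (G' - G) F
      ∈ fil 𝕜 wt (M + 1) := by
  have h1 := fil_mono (Nat.le_succ _) ((raises_ham e hG').expSeries_sub_mem (M + 2) F)
  have h2 := fil_mono (Nat.le_succ _) ((raises_ham e hG).expSeries_sub_mem (M + 2) F)
  have h3 : expTrunc (hamEnd e G') (M + 2) F - expTrunc (hamEnd e G) (M + 2) F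
      - ham e (G' - G) F ∈ fil 𝕜 wt (M + 1) := by
    have : expTrunc (hamEnd e G') (M + 2) F - expTrunc (hamEnd e G) (M + 2) F
        - ham e (G' - G) F = ∑ k ∈ Finset.range M, ((k + 2).factorial : 𝕜)⁻¹ •
          ((hamEnd e G' ^ (k + 2)) F - (hamEnd e G ^ (k + 2)) F) := by
      rw [expTrunc_apply, expTrunc_apply, Finset.sum_range_succ', Finset.sum_range_succ',
        Finset.sum_range_succ', Finset.sum_range_succ']
      simp only [smul_sub, Finset.sum_sub_distrib, ham_sub, Derivation.sub_apply, zero_add,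
        Nat.factorial_one, Nat.factorial_zero, Nat.cast_one, inv_one, one_smul, pow_one, pow_zero,
        Module.End.one_apply, hamEnd, Derivation.coeFn_coe]
      abel
    rw [this]
    exact sum_mem fun k _ => Submodule.smul_mem _ _ (pow_hamEnd_sub_mem e hG hG' hGG' hF k)
  have := add_mem (sub_mem h1 h2) h3
  convert! this using 1
  abel

/-- The Birkhoff normalization: a formal canonical transformation makes `H` commute with the
semisimple part of its quadratic part. -/
theorem exists_normalization [CharZero 𝕜] {S A : Matrix (Coord l m) (Coord l m) 𝕜}
    (h : IsSemisimplePart S A) (hS : WeightPreserving S) (hA : WeightPreserving A)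
    {H h₂ : FormalFn 𝕜 l m} (hH : H - h₂ ∈ fil 𝕜 wt 3) (hh₂ : h₂ ∈ fil 𝕜 wt 2)
    (hham : ham e h₂ = linDerivation A) (hSh : linDerivation S h₂ = 0) :
    ∃ G ∈ fil 𝕜 wt 3, linDerivation S (expSeries wt (hamEnd e G) H) = 0 := by
  have hH2 : H ∈ fil 𝕜 wt 2 := by
    have := add_mem (fil_mono (by omega) hH) hh₂
    rwa [sub_add_cancel] at this
  -- `P n G`: the series transformed by `exp {G, ·}` lies in `ker S` up to weight at least `n + 3`.
  let P : ℕ → FormalFn 𝕜 l m → Prop := fun n G => G ∈ fil 𝕜 wt 3 ∧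
    ∃ R, linDerivation S R = 0 ∧ expSeries wt (hamEnd e G) H - R ∈ fil 𝕜 wt (n + 3)
  have h0 : P 0 0 := by
    refine ⟨zero_mem _, h₂, hSh, ?_⟩
    have h1 := (raises_ham e (zero_mem _)).expSeries_sub_self_mem hH2
    have := add_mem h1 hH
    rwa [sub_add_sub_cancel] at this
  have hstep : ∀ n (G : {G // P n G}), ∃ G' : {G // P (n + 1) G},
      G'.1 - G.1 ∈ fil 𝕜 wt (n + 3) := by
    rintro n ⟨G, hG, R, hR, hGR⟩
    obtain ⟨r, hr, u, hu, hSr, hru⟩ := exists_homological h hS hA hGR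
    have hG' : G + u ∈ fil 𝕜 wt 3 := add_mem hG (fil_mono (by omega) hu)
    refine ⟨⟨G + u, hG', R + r, by rw [map_add, hR, hSr, add_zero], ?_⟩, by simpa using hu⟩
    have hsub : G + u - G = u := add_sub_cancel_left G u
    have h1 := expSeries_ham_sub_mem e hG hG' (M := n + 3) (by rwa [hsub]) hH2
    rw [hsub] at h1
    -- Adding `u` to `G` changes the transformed series by `{u, H}`, which is `{u, h₂} = -{h₂, u}`
    -- up to higher weight; this cancels the non-resonant part of the error and leaves `r`.
    have h2 := ham_mem_fil e hu hH
    rw [map_sub, ham_skew e h₂ u, hham, sub_neg_eq_add] at h2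
    have h3 := add_mem (add_mem h1 hru) (fil_mono (show n + 3 + 1 ≤ n + 3 + 3 - 2 by omega) h2)
    rw [show n + 1 + 3 = n + 3 + 1 by omega]
    convert! h3 using 1
    abel
  choose next hnext using hstep
  let g : ∀ n, {G // P n G} := fun n => Nat.rec ⟨0, h0⟩ next n
  obtain ⟨G, hG⟩ := exists_limit_of_fil (w := wt) (fun n => (g n).1) 3
    (fun n => hnext n (g n)) (by omega)
  have hG3 : G ∈ fil 𝕜 wt 3 := by
    have := add_mem (hG 0) (g 0).2.1
    rwa [sub_add_cancel] at this
  refine ⟨G, hG3, eq_zero_of_forall_mem_fil (w := wt) 0 fun n => ?_⟩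
  obtain ⟨hgn, R, hR, hgR⟩ := (g n).2
  have h1 := expSeries_ham_sub_mem e hgn hG3 (hG n) hH2
  have h2 := add_mem (add_mem (fil_mono (Nat.le_succ _) h1) (fil_mono (by omega)
    (ham_mem_fil e (hG n) hH2))) hgR
  rw [sub_add_cancel, sub_add_sub_cancel] at h2
  have h3 := hS.linDerivation_mem_fil h2
  rw [map_sub, hR, sub_zero] at h3
  exact fil_mono (by omega) h3

end Normalization

/-! ### Linear parts of formal vector fields. -/

section LinearPart

variable {l m : ℕ} {𝕜 : Type*} [Field 𝕜]

theorem linearPart_linearVF (A : Matrix (Coord l m) (Coord l m) 𝕜) :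
    linearPart (linearVF A) = A := by
  ext a b
  rw [linearPart, Matrix.of_apply, linearVF_apply, ← constantCoeff_pderiv, pderiv_linFn,
    constantCoeff_C]

theorem linearPart_sub (V W : FormalVF 𝕜 l m) :
    linearPart (V - W) = linearPart V - linearPart W := by
  ext a b
  simp [linearPart]

theorem weightRaising_linearPart {V : FormalVF 𝕜 l m} (hV : ∀ a, V a ∈ fil 𝕜 wt (wt a + 1)) :
    WeightRaising (linearPart V) := fun a b hab => by
  refine hV a _ ?_
  rw [Finsupp.weight_single]
  simpa using Nat.lt_succ_of_le hab

theorem coeff_single_linFn_mul (v : Coord l m → 𝕜) (f : FormalFn 𝕜 l m) (c : Coord l m) :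
    coeff (Finsupp.single c 1) (linFn v * f) = v c * constantCoeff f := by
  rw [← constantCoeff_pderiv, Derivation.leibniz, pderiv_linFn, map_add, smul_eq_mul, smul_eq_mul,
    map_mul, map_mul, linFn_eq_zero_coeff, zero_mul, zero_add, constantCoeff_C, mul_comm]

end LinearPart

/-! ### The canonical transformations `exp {G, ·}`. -/

section CanonicalTransformation

variable {l m : ℕ} {𝕜 : Type*} [Field 𝕜] [CharZero 𝕜] {𝔤 : Type*} [LieRing 𝔤] [LieAlgebra 𝕜 𝔤]
  (e : Module.Basis (Fin m) 𝕜 𝔤)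

/-- The algebra endomorphism `exp {G, ·}`. -/
noncomputable def flow (G : FormalFn 𝕜 l m) (hG : G ∈ fil 𝕜 wt 3) :
    FormalFn 𝕜 l m →ₐ[𝕜] FormalFn 𝕜 l m := expAlgHom wt (ham e G) (raises_ham e hG)

variable {G : FormalFn 𝕜 l m} (hG : G ∈ fil 𝕜 wt 3)

theorem flow_apply (f : FormalFn 𝕜 l m) : flow e G hG f = expSeries wt (hamEnd e G) f := rfl

/-- By the Jacobi identity `{G, ·}` is a derivation of the bracket; the parameter 2 is the weight
that the bracket loses. -/
theorem flow_ham (f g : FormalFn 𝕜 l m) :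
    flow e G hG (ham e f g) = ham e (flow e G hG f) (flow e G hG g) :=
  (raises_ham e hG).expSeries_bilin 2 (bracketBilin e)
    (fun _ _ _ _ hf hg => ham_mem_fil e hf hg) (fun f g => ham_ham e G f g) f g

theorem flow_neg_flow (f : FormalFn 𝕜 l m) :
    flow e (-G) (neg_mem hG) (flow e G hG f) = f := by
  have h : hamEnd e (-G) = -hamEnd e G := LinearMap.ext fun f =>
    LinearMap.congr_fun (map_neg (bracketBilin e) G) f
  rw [flow_apply, flow_apply, h]
  exact (raises_ham e hG).expSeries_neg_apply f

theorem flow_mem_fil {n : ℕ} {f : FormalFn 𝕜 l m} (hf : f ∈ fil 𝕜 wt n) :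
    flow e G hG f ∈ fil 𝕜 wt n := (raises_ham e hG).expSeries_mem hf

theorem flow_sub_mem_fil {n : ℕ} {f : FormalFn 𝕜 l m} (hf : f ∈ fil 𝕜 wt n) :
    flow e G hG f - f ∈ fil 𝕜 wt (n + 1) := (raises_ham e hG).expSeries_sub_self_mem hf

theorem constantCoeff_flow_X (a : Coord l m) : constantCoeff (flow e G hG (X a)) = 0 := by
  have := flow_mem_fil e hG (X_mem_fil a) 0
    (by rw [map_zero]; exact one_le_wt a)
  simpa using this

theorem flow_eq_subst (f : FormalFn 𝕜 l m) :
    flow e G hG f = subst (fun a => flow e G hG (X a)) f :=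
  algHom_eq_subst one_le_wt _ (fun _ _ hf => flow_mem_fil e hG hf)
    (hasSubst_of_constantCoeff_zero (constantCoeff_flow_X e hG)) f

theorem flow_C (c : 𝕜) : flow e G hG (C c) = C c := (flow e G hG).commutes c

theorem isCanonicalCoords_flow : IsCanonicalCoords e fun a => flow e G hG (X a) where
  vanish := constantCoeff_flow_X e hG
  invertible := by
    rw [← Matrix.isUnit_iff_isUnit_det]
    -- The Jacobian at 0 is the identity plus a weight-raising, hence square-zero, matrix.
    have h1 : WeightRaising (linearPart ((fun a => flow e G hG (X a)) - linearVF 1)) :=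
      weightRaising_linearPart fun a => by
        have : linearVF (1 : Matrix (Coord l m) (Coord l m) 𝕜) a = X a := by
          rw [linearVF_apply, ← linFn_single]
          congr 1
          ext b
          rw [Matrix.one_apply, Pi.single_apply]
          simp [eq_comm]
        rw [Pi.sub_apply, this]
        exact flow_sub_mem_fil e hG (X_mem_fil a)
    rw [linearPart_sub, linearPart_linearVF] at h1
    have h2 : IsNilpotent (linearPart (fun a => flow e G hG (X a)) - 1) :=
      ⟨2, by rw [pow_two, h1.mul_self]⟩
    simpa using h2.isUnit_one_add
  bracket_x_x i j := by rw [← ham_apply, ← flow_ham, ham_x_x, map_zero]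
  bracket_y_y i j := by rw [← ham_apply, ← flow_ham, ham_y_y, map_zero]
  bracket_x_y i j := by
    rw [← ham_apply, ← flow_ham, ham_x_y]
    split_ifs
    · exact map_one _
    · exact map_zero _
  bracket_x_z i j := by rw [← ham_apply, ← flow_ham, ham_x_z, map_zero]
  bracket_y_z i j := by rw [← ham_apply, ← flow_ham, ham_y_z, map_zero]
  bracket_z_z i j := by
    rw [← ham_apply, ← flow_ham, ham_z_z, map_sum]
    exact Finset.sum_congr rfl fun k _ => by rw [map_mul, flow_C]

/-- A canonical transformation expresses Hamiltonian vector fields as Hamiltonian vector fields. -/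
theorem isExpressionIn_flow (f : FormalFn 𝕜 l m) :
    IsExpressionIn (fun a => flow e G hG (X a)) (hamVF e (flow e G hG f)) (hamVF e f) := by
  intro a
  rw [hamVF_deriv, ← ham_apply, ← flow_ham, flow_eq_subst, hamVF, ham_apply]

/-- The linear part of a Hamiltonian vector field commuting with a linear Hamiltonian vector field
commutes with the matrix of the latter. -/
theorem commute_linearPart {S : Matrix (Coord l m) (Coord l m) 𝕜} {s f : FormalFn 𝕜 l m}
    (hs : ham e s = linDerivation S) (h : ham e s f = 0) : Commute S (linearPart (hamVF e f)) := by
  have h0 : ham e (0 : FormalFn 𝕜 l m) = 0 := by simpa using ham_C e (0 : 𝕜)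
  have h1 : ∀ a, linDerivation S (hamVF e f a) = ∑ b, C (S a b) * hamVF e f b := by
    intro a
    -- With `{s, f} = 0` the Jacobi identity says that the linear field of `S` and `X_f` commute;
    -- the linear terms of this relation give the commuting matrices.
    have h2 := ham_ham e s f (X a)
    rw [h, h0, Derivation.zero_apply, zero_add, hs, vfDerivation_X, linearVF_apply,
      derivation_linFn] at h2
    simp only [ham_apply] at h2
    exact h2
  ext a c
  have h2 := congrArg (coeff (Finsupp.single c 1)) (h1 a)
  rw [vfDerivation_apply, FormalVF.deriv, map_sum, map_sum] at h2
  simp only [linearVF_apply, coeff_single_linFn_mul, coeff_C_mul, constantCoeff_pderiv] at h2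
  rw [Matrix.mul_apply, Matrix.mul_apply]
  simp only [linearPart, Matrix.of_apply]
  rw [← h2]
  exact Finset.sum_congr rfl fun b _ => mul_comm _ _

end CanonicalTransformation

end FormalPoisson

/-! ### Assembly of the normal form. -/

open MvPowerSeries FormalPoisson
theorem theoremC {𝕜 : Type*} [RCLike 𝕜]
    {𝔤 : Type*} [LieRing 𝔤] [LieAlgebra 𝕜 𝔤] [LieAlgebra.IsSemisimple 𝕜 𝔤]
    (l m : ℕ) (e : Module.Basis (Fin m) 𝕜 𝔤)
    (H : FormalFn 𝕜 l m)
    (hH : ∀ a, constantCoeff (hamVF e H a) = 0) :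
    ∃ φ : Coord l m → FormalFn 𝕜 l m, IsCanonicalCoords e φ ∧
      ∃ (Hss : MvPolynomial (Coord l m) 𝕜) (Htilde : FormalFn 𝕜 l m),
        Hss.totalDegree ≤ 2 ∧ MvPolynomial.constantCoeff Hss = 0 ∧
        H = subst φ ((Hss : FormalFn 𝕜 l m) + Htilde) ∧
        bracket e H (subst φ (Hss : FormalFn 𝕜 l m)) = 0 ∧
        ∃ (W : FormalVF 𝕜 l m) (S : Matrix (Coord l m) (Coord l m) 𝕜),
          IsExpressionIn φ (hamVF e H) W ∧
          IsExpressionIn φ (hamVF e (subst φ (Hss : FormalFn 𝕜 l m))) (linearVF S) ∧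
          IsSemisimplePart S (linearPart W) := by
  have : FiniteDimensional 𝕜 𝔤 := Module.Finite.of_basis e
  obtain ⟨Q, ξ, hQ, hQz, hQH⟩ := exists_quadHam_leading_part e H hH
  obtain ⟨Q', τ, hQ', hQz', hpart⟩ := exists_hamMatrix_semisimplePart e hQ hQz ξ
  set A := hamMatrix e Q ξ with hAdef
  set S := hamMatrix e Q' τ with hSdef
  have hA : WeightPreserving A := fun a b => hamMatrix_eq_zero_of_wt_ne e hQ hQz ξ
  have hS : WeightPreserving S := fun a b => hamMatrix_eq_zero_of_wt_ne e hQ' hQz' τ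
  set h₂ : FormalFn 𝕜 l m := (quadHam e Q ξ : FormalFn 𝕜 l m) with hh₂def
  set s : FormalFn 𝕜 l m := (quadHam e Q' τ : FormalFn 𝕜 l m) with hsdef
  have hh₂ : ham e h₂ = linDerivation A := ham_quadHam e hQ hQz ξ
  have hs : ham e s = linDerivation S := ham_quadHam e hQ' hQz' τ
  have hself : ham e h₂ h₂ = 0 := by
    have h1 := ham_skew e h₂ h₂
    have h2 : (2 : 𝕜) • ham e h₂ h₂ = 0 := by
      rw [two_smul]
      exact eq_neg_iff_add_eq_zero.mp h1
    exact (smul_eq_zero.mp h2).resolve_left two_ne_zero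
  have hSh₂ : linDerivation S h₂ = 0 :=
    linDerivation_eq_zero_of_semisimplePart hpart _ (by rw [← hh₂]; exact hself)
  have hh₂fil : h₂ ∈ fil 𝕜 wt 2 := quadHam_mem_fil e Q ξ
  set c := constantCoeff H
  obtain ⟨G, hG, hnorm⟩ := exists_normalization e hpart hS hA hQH hh₂fil hh₂ hSh₂
  set H' : FormalFn 𝕜 l m := flow e G hG H with hH'def
  have hG' : -G ∈ fil 𝕜 wt 3 := neg_mem hG
  have hback : flow e (-G) hG' H' = H := flow_neg_flow e hG H
  -- The normalization was applied to `H - C c`; constants are fixed by the flow and central, so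
  -- `{s, H'} = 0` follows.
  have hsplit : H' = flow e G hG (H - C c) + C c := by
    rw [map_sub, flow_C, sub_add_cancel]
  have hsH' : ham e s H' = 0 := by
    rw [hsplit, map_add, ham_apply_C, add_zero, hs]
    exact hnorm
  have hH's : ham e H' s = 0 := by rw [ham_skew, hsH', neg_zero]
  have hH'fil : H' - C c - h₂ ∈ fil 𝕜 wt 3 := by
    have h1 : H - C c ∈ fil 𝕜 wt 2 := by
      have := add_mem (fil_mono (by omega) hQH) hh₂fil
      rwa [sub_add_cancel] at this
    have h2 := add_mem (flow_sub_mem_fil e hG h1) hQH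
    rw [sub_add_sub_cancel] at h2
    rwa [hsplit, add_sub_cancel_right]
  -- Substituting these coordinates is the inverse flow, which takes `H'` back to `H`; so `H'` is
  -- the expression of `H` in them, and `W` is `X_{H'}`.
  refine ⟨fun a => flow e (-G) hG' (X a), isCanonicalCoords_flow e hG', quadHam e Q' τ, H' - s,
    quadHam_totalDegree_le e Q' τ, quadHam_constantCoeff e Q' τ, ?_, ?_, hamVF e H', S, ?_, ?_,
    hpart.1, ?_, ?_⟩
  · rw [← hsdef, add_sub_cancel, ← flow_eq_subst, hback]
  · rw [← hsdef, ← flow_eq_subst, ← hback, ← ham_apply, ← flow_ham, hH's, map_zero]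
  · have := isExpressionIn_flow e hG' H'
    rwa [hback] at this
  · rw [← hsdef, ← flow_eq_subst, hSdef, ← hamVF_quadHam e hQ' hQz' τ]
    exact isExpressionIn_flow e hG' s
  -- `H' - C c - h₂` has weight at least 3, so its field contributes only weight-raising linear
  -- terms besides `A`.
  · have hraise : WeightRaising (linearPart (hamVF e H' - linearVF A)) :=
      weightRaising_linearPart fun a => by
        have h1 : (hamVF e H' - linearVF A) a = ham e (H' - C c - h₂) (X a) := by
          rw [ham_sub, ham_sub, ham_C, sub_zero, Derivation.sub_apply, hh₂, vfDerivation_X,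
            ham_apply]
          rfl
        rw [h1]
        exact fil_mono (by omega) (ham_mem_fil e hH'fil (X_mem_fil a))
    rw [linearPart_sub, linearPart_linearVF] at hraise
    have := (hA.sub hS).isNilpotent_add hraise hpart.2.1
    rwa [add_comm, sub_add_sub_cancel] at this
  · exact (commute_linearPart e hs hsH').sub_right (Commute.refl S)
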